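/- Notation. Let $G$ be a finite group. For $m\ge 1$, $G$ is called an $FSZ_m$-group if, for every simple module $V$ over the Drinfeld double $D(G)$ of $G$ over $\mathbb C$, the $m$-th Frobenius--Schur indicator $\nu_m(V)=\chi_V(\Lambda_{(1)}\Lambda_{(2)}\cdots\Lambda_{(m)})$ is an integer, where $\Lambda$ is the normalized two-sided integral of $D(G)$ and $\chi_V$ is the character of $V$. For $z\in G$ and $g\in C_G(z)$ put $\gamma_m^z(g)=|\{x\in G : x^m=(gx)^m=z\}|$. This is a class function on $C_G(z)$, and the complex numbers $\beta_m(z,\chi)$, for $\chi\in\mathrm{Irr}(C_G(z))$, are its coefficients in the expansion $\gamma_m^z=\sum_{\chi\in\mathrm{Irr}(C_G(z))}\beta_m(z,\chi)\,\chi$. A $p$-element is an element whose order is a power of $p$. The $p$-part of $y\in G$ is the unique $p$-element $y_p$ such that $y=y_pw=wy_p$ for some $w\in G$ of order prime to $p$. Theorem. Let $q$ be a power of a prime $p$ and let $G$ be a finite group. (1) If $G$ is not an $FSZ_q$-group, then there is a $p$-element $z\in G$, $z\neq 1$, such that the centralizer $C_G(z)$ is not an $FSZ_q$-group. (2) If $y\in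 Z(G)$ and $y_p$ is the $p$-part of $y$, then $\beta_q(y,\chi)=\beta_q(y_p,\chi)$ for every $\chi\in\mathrm{Irr}(G)$ (note that $y_p\in Z(G)$ as well, so $C_G(y)=C_G(y_p)=G$). -/

import Mathlib

universe u

open scoped TensorProduct MonoidAlgebra

namespace FSZ

/-- The Drinfeld double `D(G)` over `ℂ` of a finite group, with basis `e_g x` for `(g, x) ∈ G × G`;
an element is stored as its family of coefficients. The Hopf structure is
`(e_g x)(e_h y) = δ_{g, x h x⁻¹} e_g (x y)`, `1 = ∑_g e_g 1`,
`Δ(e_g x) = ∑_{a b = g} e_a x ⊗ e_b x` and `ε(e_g x) = δ_{g, 1}`. -/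
def DrinfeldDouble (G : Type u) : Type u := G × G → ℂ

namespace DrinfeldDouble
variable {G : Type u}

noncomputable instance : AddCommGroup (DrinfeldDouble G) :=
  inferInstanceAs (AddCommGroup (G × G → ℂ))

noncomputable instance : Module ℂ (DrinfeldDouble G) :=
  inferInstanceAs (Module ℂ (G × G → ℂ))

@[ext] theorem ext {a b : DrinfeldDouble G} (h : ∀ g x, a (g, x) = b (g, x)) : a = b :=
  funext fun p => h p.1 p.2

@[simp] theorem add_apply (a b : DrinfeldDouble G) (p : G × G) : (a + b) p = a p + b p := rfl
@[simp] theorem smul_apply (c : ℂ) (a : DrinfeldDouble G) (p : G × G) : (c • a) p = c * a p := rfl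
@[simp] theorem zero_apply (p : G × G) : (0 : DrinfeldDouble G) p = 0 := rfl

section Mul

variable [Group G]

noncomputable instance [DecidableEq G] : One (DrinfeldDouble G) :=
  ⟨fun p => if p.2 = 1 then 1 else 0⟩

noncomputable instance [Fintype G] : Mul (DrinfeldDouble G) :=
  ⟨fun a b p => ∑ y : G, a (p.1, y) * b (y⁻¹ * p.1 * y, y⁻¹ * p.2)⟩

theorem one_apply [DecidableEq G] (g x : G) :
    (1 : DrinfeldDouble G) (g, x) = if x = 1 then 1 else 0 := rfl

theorem mul_apply [Fintype G] (a b : DrinfeldDouble G) (g x : G) :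
    (a * b) (g, x) = ∑ y : G, a (g, y) * b (y⁻¹ * g * y, y⁻¹ * x) := rfl

end Mul

variable [Fintype G] [DecidableEq G]

/-- The basis of the elements `e_g x`. -/
noncomputable def basis : Module.Basis (G × G) ℂ (DrinfeldDouble G) := Pi.basisFun ℂ (G × G)

theorem basis_apply (p r : G × G) : (basis p : DrinfeldDouble G) r = if r = p then 1 else 0 := by
  change (Pi.basisFun ℂ (G × G)) p r = _
  simp [Pi.single_apply]

variable [Group G]

noncomputable instance : Ring (DrinfeldDouble G) :=
  { (inferInstance : AddCommGroup (DrinfeldDouble G)) with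
    one := 1
    mul := (· * ·)
    left_distrib := fun a b c => by
      ext g x; simp [mul_apply, mul_add, Finset.sum_add_distrib]
    right_distrib := fun a b c => by
      ext g x; simp [mul_apply, add_mul, Finset.sum_add_distrib]
    zero_mul := fun a => by ext g x; simp [mul_apply]
    mul_zero := fun a => by ext g x; simp [mul_apply]
    mul_assoc := fun a b c => by
      ext g x
      simp only [mul_apply, Finset.sum_mul, Finset.mul_sum]
      rw [Finset.sum_comm]
      refine Finset.sum_congr rfl fun y _ => ?_
      refine Fintype.sum_equiv (Equiv.mulLeft y⁻¹) _ _ fun w => ?_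
      simp [mul_assoc]
    one_mul := fun a => by
      ext g x
      simp [mul_apply, one_apply]
    mul_one := fun a => by
      ext g x
      simp [mul_apply, one_apply, inv_mul_eq_one] }

noncomputable instance : Algebra ℂ (DrinfeldDouble G) :=
  Algebra.ofModule
    (fun c a b => by ext g x; simp [mul_apply, Finset.mul_sum, mul_assoc])
    (fun c a b => by
      ext g x
      simp only [mul_apply, smul_apply, Finset.mul_sum]
      exact Finset.sum_congr rfl fun y _ => by ring)

theorem basis_mul_basis (g x h y : G) :
    (basis (g, x) : DrinfeldDouble G) * basis (h, y) =
      if g = x * h * x⁻¹ then basis (g, x * y) else 0 := by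
  ext k z
  rw [mul_apply, Finset.sum_eq_single x]
  · split_ifs with hg
    · subst hg
      simp only [basis_apply, Prod.mk.injEq, and_true, ite_mul, one_mul, zero_mul,
        inv_mul_eq_iff_eq_mul]
      by_cases hk : k = x * h * x⁻¹
      · subst hk; simp [mul_assoc]
      · simp [hk]
    · simp only [basis_apply, Prod.mk.injEq, and_true, ite_mul, one_mul, zero_mul, zero_apply]
      split_ifs with h1 h2
      · exact absurd (by rw [← h2.1, h1]; group) hg
      all_goals rfl
  · intro w _ hw
    simp [basis_apply, hw]
  · simp

theorem one_eq_sum : (1 : DrinfeldDouble G) = ∑ g : G, basis (g, 1) := by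
  ext k z
  have : ∀ (s : Finset G), (∑ g ∈ s, (basis (g, 1) : DrinfeldDouble G)) (k, z) =
      ∑ g ∈ s, (basis (g, 1) : DrinfeldDouble G) (k, z) := fun s => Finset.sum_apply _ _ _
  rw [this, one_apply]
  simp [basis_apply, Prod.mk.injEq, ite_and]

noncomputable instance : CoalgebraStruct ℂ (DrinfeldDouble G) where
  comul := basis.constr ℂ fun p => ∑ h : G, basis (h, p.2) ⊗ₜ[ℂ] basis (h⁻¹ * p.1, p.2)
  counit := basis.constr ℂ fun p => if p.1 = 1 then 1 else 0

theorem comul_basis (g x : G) :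
    Coalgebra.comul (R := ℂ) (basis (g, x) : DrinfeldDouble G) =
      ∑ h : G, basis (h, x) ⊗ₜ[ℂ] basis (h⁻¹ * g, x) :=
  basis.constr_basis ℂ _ _

theorem counit_basis (g x : G) :
    Coalgebra.counit (R := ℂ) (basis (g, x) : DrinfeldDouble G) = if g = 1 then 1 else 0 :=
  basis.constr_basis ℂ _ _

noncomputable instance : Coalgebra ℂ (DrinfeldDouble G) where
  coassoc := by
    refine basis.ext fun ⟨g, x⟩ => ?_
    simp only [LinearMap.comp_apply, LinearEquiv.coe_coe, comul_basis, map_sum,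
      LinearMap.rTensor_tmul, LinearMap.lTensor_tmul, TensorProduct.sum_tmul,
      TensorProduct.tmul_sum, TensorProduct.assoc_tmul]
    rw [Finset.sum_comm]
    refine Finset.sum_congr rfl fun h _ => ?_
    refine Fintype.sum_equiv (Equiv.mulLeft h⁻¹) _ _ fun k => ?_
    simp [mul_assoc]
  rTensor_counit_comp_comul := by
    refine basis.ext fun ⟨g, x⟩ => ?_
    simp only [LinearMap.comp_apply, comul_basis, map_sum, LinearMap.rTensor_tmul, counit_basis,
      TensorProduct.mk_apply]
    rw [Finset.sum_eq_single 1]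
    · simp
    · intro h _ hh; simp [hh]
    · simp
  lTensor_counit_comp_comul := by
    refine basis.ext fun ⟨g, x⟩ => ?_
    simp only [LinearMap.comp_apply, comul_basis, map_sum, LinearMap.lTensor_tmul, counit_basis,
      TensorProduct.mk_apply, LinearMap.flip_apply]
    rw [Finset.sum_eq_single g]
    · simp
    · intro h _ hh; simp [inv_mul_eq_one, hh]
    · simp

noncomputable instance : Bialgebra ℂ (DrinfeldDouble G) where
  counit_one := by
    simp [one_eq_sum, map_sum, counit_basis]
  mul_compr₂_counit := by
    refine basis.ext fun ⟨g, x⟩ => basis.ext fun ⟨h, y⟩ => ?_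
    simp only [LinearMap.compr₂_apply, LinearMap.mul_apply', LinearMap.compl₁₂_apply,
      basis_mul_basis, counit_basis]
    by_cases hg : g = 1
    · subst hg
      by_cases hh : h = 1
      · simp [hh, counit_basis]
      · have : ¬ (1 : G) = x * h * x⁻¹ := fun e => hh (by simpa [eq_mul_inv_iff_mul_eq] using e)
        simp [hh, this]
    · split_ifs <;> simp [counit_basis, hg]
  comul_one := by
    simp only [one_eq_sum, map_sum, comul_basis, Algebra.TensorProduct.one_def,
      TensorProduct.sum_tmul, TensorProduct.tmul_sum]
    rw [Finset.sum_comm]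
    nth_rewrite 2 [Finset.sum_comm]
    refine Finset.sum_congr rfl fun h _ => ?_
    exact Fintype.sum_equiv (Equiv.mulLeft h⁻¹) _ _ fun k => rfl
  mul_compr₂_comul := by
    refine basis.ext fun ⟨g, x⟩ => basis.ext fun ⟨h, y⟩ => ?_
    simp only [LinearMap.compr₂_apply, LinearMap.mul_apply', LinearMap.compl₁₂_apply,
      basis_mul_basis, comul_basis, Finset.sum_mul, Finset.mul_sum,
      Algebra.TensorProduct.tmul_mul_tmul]
    have key : ∀ k l : G,
        ((if k = x * l * x⁻¹ then (basis (k, x * y) : DrinfeldDouble G) else 0) ⊗ₜ[ℂ]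
          (if k⁻¹ * g = x * (l⁻¹ * h) * x⁻¹ then (basis (k⁻¹ * g, x * y) : DrinfeldDouble G)
            else 0)) =
        if l = x⁻¹ * k * x then (if g = x * h * x⁻¹ then
          (basis (k, x * y) : DrinfeldDouble G) ⊗ₜ[ℂ]
          (basis (k⁻¹ * g, x * y) : DrinfeldDouble G) else 0) else 0 := by
      intro k l
      by_cases h1 : k = x * l * x⁻¹
      · have h1' : l = x⁻¹ * k * x := by rw [h1]; group
        have h2 : (k⁻¹ * g = x * (l⁻¹ * h) * x⁻¹) ↔ g = x * h * x⁻¹ := by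
          rw [inv_mul_eq_iff_eq_mul, h1]
          constructor <;> intro e <;> rw [e] <;> group
        rw [if_pos h1, if_pos h1']
        by_cases h3 : g = x * h * x⁻¹
        · rw [if_pos h3, if_pos (h2.2 h3)]
        · rw [if_neg h3, if_neg (mt h2.1 h3), TensorProduct.tmul_zero]
      · have h1' : ¬ l = x⁻¹ * k * x := fun e => h1 (by rw [e]; group)
        rw [if_neg h1, if_neg h1', TensorProduct.zero_tmul]
    simp only [key]
    rw [Finset.sum_comm]
    simp only [Finset.sum_ite_eq', Finset.mem_univ, if_true]
    split_ifs with hg <;> simp [comul_basis]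

/-- The normalized two-sided integral `Λ = |G|⁻¹ ∑_x e_1 x` of `D(G)`. -/
noncomputable def integral : DrinfeldDouble G := (Fintype.card G : ℂ)⁻¹ • ∑ x : G, basis (1, x)

theorem mul_integral (a : DrinfeldDouble G) :
    a * integral = Coalgebra.counit (R := ℂ) a • integral := by
  suffices h : LinearMap.mulRight ℂ (integral : DrinfeldDouble G) =
      (Coalgebra.counit (R := ℂ)).smulRight integral from LinearMap.congr_fun h a
  refine basis.ext fun ⟨g, x⟩ => ?_
  simp only [LinearMap.mulRight_apply, LinearMap.smulRight_apply, integral, mul_smul_comm,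
    Finset.mul_sum, basis_mul_basis, counit_basis, mul_one, mul_inv_cancel]
  by_cases hg : g = 1
  · subst hg
    simp only [if_true, one_smul]
    congr 1
    exact Fintype.sum_equiv (Equiv.mulLeft x) _ _ fun k => rfl
  · simp [hg]

theorem integral_mul (a : DrinfeldDouble G) :
    integral * a = Coalgebra.counit (R := ℂ) a • integral := by
  suffices h : LinearMap.mulLeft ℂ (integral : DrinfeldDouble G) =
      (Coalgebra.counit (R := ℂ)).smulRight integral from LinearMap.congr_fun h a
  refine basis.ext fun ⟨g, x⟩ => ?_
  simp only [LinearMap.mulLeft_apply, LinearMap.smulRight_apply, integral, smul_mul_assoc,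
    Finset.sum_mul, basis_mul_basis, counit_basis]
  by_cases hg : g = 1
  · subst hg
    simp only [mul_one, mul_inv_cancel, if_true, one_smul]
    congr 1
    exact Fintype.sum_equiv (Equiv.mulRight x) _ _ fun k => rfl
  · have : ∀ k : G, ¬ (1 : G) = k * g * k⁻¹ := fun k e =>
      hg (conj_eq_one_iff.1 e.symm)
    simp [hg, this]

theorem counit_integral : Coalgebra.counit (R := ℂ) (integral : DrinfeldDouble G) = 1 := by
  simp [integral, map_sum, counit_basis]

end DrinfeldDouble

/-- The `m`-th Sweedler power `a ↦ a₍₁₎ a₍₂₎ ⋯ a₍ₘ₎`, the `m`-th convolution power of the identity. -/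
noncomputable def sweedlerPower (A : Type u) [Semiring A] [Bialgebra ℂ A] (m : ℕ) : A →ₗ[ℂ] A :=
  ((WithConv.toConv LinearMap.id : WithConv (A →ₗ[ℂ] A)) ^ m).ofConv

/-- The `m`-th Frobenius-Schur indicator `ν_m(V) = χ_V(Λ₍₁₎ Λ₍₂₎ ⋯ Λ₍ₘ₎)` of a `D(G)`-module. -/
noncomputable def nu (G : Type u) [Group G] [Fintype G] [DecidableEq G] (m : ℕ)
    (V : Type u) [AddCommGroup V] [Module ℂ V] [Module (DrinfeldDouble G) V]
    [IsScalarTower ℂ (DrinfeldDouble G) V] : ℂ :=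
  LinearMap.trace ℂ V (Algebra.lsmul ℂ ℂ V
    (sweedlerPower (DrinfeldDouble G) m DrinfeldDouble.integral))

/-- `G` is an `FSZ_m`-group: `ν_m(V) ∈ ℤ` for every simple `D(G)`-module `V`. -/
def IsFSZ (G : Type u) [Group G] [Finite G] (m : ℕ) : Prop :=
  letI : Fintype G := Fintype.ofFinite G
  letI : DecidableEq G := Classical.decEq G
  ∀ (V : Type u) [AddCommGroup V] [Module ℂ V] [Module (DrinfeldDouble G) V]
    [IsScalarTower ℂ (DrinfeldDouble G) V] [IsSimpleModule (DrinfeldDouble G) V],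
    ∃ n : ℤ, nu G m V = n

/-- `Irr(H)`: the set of complex irreducible characters of `H`. -/
def irrChar (H : Type u) [Group H] : Set (H → ℂ) :=
  {χ | ∃ (V : Type u) (_ : AddCommGroup V) (_ : Module ℂ V) (_ : FiniteDimensional ℂ V)
    (ρ : Representation ℂ H V), ρ.IsIrreducible ∧ ρ.character = χ}

section
variable {H : Type u} [Group H]

theorem irrChar_conj {χ : H → ℂ} (hχ : χ ∈ irrChar H) (g h : H) : χ (h * g * h⁻¹) = χ g := by
  obtain ⟨V, _, _, _, ρ, -, rfl⟩ := hχ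
  exact ρ.char_conj g h

variable [Fintype H]

theorem irrChar_orthonormal [DecidableEq (H → ℂ)] {χ ψ : H → ℂ} (hχ : χ ∈ irrChar H)
    (hψ : ψ ∈ irrChar H) :
    (Nat.card H : ℂ)⁻¹ * ∑ g : H, χ g * ψ g⁻¹ = if χ = ψ then 1 else 0 := by
  obtain ⟨V, _, _, _, ρ, hρ, rfl⟩ := hχ
  obtain ⟨W, _, _, _, σ, hσ, rfl⟩ := hψ
  have : Invertible (Nat.card H : ℂ) := invertibleOfNonzero (by simp [Nat.card_eq_fintype_card])
  rw [Representation.char_orthonormal ρ σ]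
  by_cases h : Nonempty (Representation.Equiv σ ρ)
  · rw [if_pos h, if_pos (Representation.char_iso h.some).symm]
  · rw [if_neg h, if_neg]
    intro e
    have h1 := Representation.char_orthonormal ρ σ
    have h2 := Representation.char_orthonormal σ σ
    rw [e, h2, if_neg h, if_pos ⟨Representation.Equiv.refl σ⟩] at h1
    exact one_ne_zero h1

theorem irrChar_linearIndependent :
    LinearIndependent ℂ (fun χ : irrChar H => (χ : H → ℂ)) := by
  classical
  rw [linearIndependent_iff']
  intro s c hc ψ hψ
  have h1 : (Nat.card H : ℂ)⁻¹ * ∑ g : H, (∑ χ ∈ s, c χ • (χ : H → ℂ)) g * (ψ : H → ℂ) g⁻¹ = 0 := by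
    rw [hc]; simp
  have h2 : (Nat.card H : ℂ)⁻¹ * ∑ g : H, (∑ χ ∈ s, c χ • (χ : H → ℂ)) g * (ψ : H → ℂ) g⁻¹ =
      ∑ χ ∈ s, c χ * ((Nat.card H : ℂ)⁻¹ * ∑ g : H, (χ : H → ℂ) g * (ψ : H → ℂ) g⁻¹) := by
    simp only [Finset.sum_apply, Pi.smul_apply, smul_eq_mul, Finset.sum_mul, Finset.mul_sum]
    rw [Finset.sum_comm]
    refine Finset.sum_congr rfl fun χ _ => Finset.sum_congr rfl fun g _ => by ring
  rw [h2] at h1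
  simp only [irrChar_orthonormal (Subtype.property _) ψ.property] at h1
  simpa [Subtype.coe_inj, hψ] using h1

instance irrChar_finite : Finite (irrChar H) :=
  (irrChar_linearIndependent (H := H)).finite

theorem sum_smul_rep_eq_zero {V : Type u} [AddCommGroup V] [Module ℂ V] [FiniteDimensional ℂ V]
    (ρ : Representation ℂ H V) [hρ : ρ.IsIrreducible] (f : H → ℂ)
    (hf : ∀ g h, f (h * g * h⁻¹) = f g)
    (h0 : ∀ χ ∈ irrChar H, ∑ g, f g * χ g⁻¹ = 0) : ∑ g, f g • ρ g⁻¹ = 0 := by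
  let T : Representation.IntertwiningMap ρ ρ :=
    ⟨∑ g, f g • ρ g⁻¹, fun h => by
      change (∑ g, f g • ρ g⁻¹) * ρ h = ρ h * ∑ g, f g • ρ g⁻¹
      simp only [Finset.sum_mul, Finset.mul_sum, smul_mul_assoc, mul_smul_comm]
      refine Fintype.sum_equiv (MulAut.conj h⁻¹).toEquiv _ _ fun g => ?_
      have : f ((MulAut.conj h⁻¹).toEquiv g) = f g := by
        simpa using hf g h⁻¹
      rw [this]
      congr 1
      rw [← map_mul, ← map_mul]
      congr 1
      simp [mul_assoc]⟩
  obtain ⟨c, hc⟩ :=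
    (Representation.IsIrreducible.algebraMap_intertwiningMap_bijective_of_isAlgClosed
      (ρ := ρ)).2 T
  have hT : ∑ g, f g • ρ g⁻¹ = c • LinearMap.id := by
    have := congrArg Representation.IntertwiningMap.toLinearMap hc
    exact this.symm
  have htr := congrArg (LinearMap.trace ℂ V) hT
  have h1 := h0 ρ.character ⟨V, _, _, inferInstance, ρ, hρ, rfl⟩
  rw [map_sum, map_smul, LinearMap.trace_id] at htr
  simp only [map_smul, smul_eq_mul] at htr
  change ∑ g, f g * ρ.character g⁻¹ = _ at htr
  rw [h1] at htr
  have : Nontrivial V := by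
    have hs := (Representation.irreducible_iff_isSimpleModule_asModule ρ).1 hρ
    exact IsSimpleModule.nontrivial ℂ[H] ρ.asModule
  have : c = 0 := by
    have := Module.finrank_pos (R := ℂ) (M := V)
    rcases mul_eq_zero.1 htr.symm with h | h
    · exact h
    · exact absurd h (by exact_mod_cast this.ne')
  rw [hT, this, zero_smul]

theorem classFun_eq_zero (f : H → ℂ) (hf : ∀ g h, f (h * g * h⁻¹) = f g)
    (h0 : ∀ χ ∈ irrChar H, ∑ g, f g * χ g⁻¹ = 0) : f = 0 := by
  have : NeZero (Nat.card H : ℂ) := ⟨by simp [Nat.card_eq_fintype_card]⟩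
  let a : ℂ[H] := ∑ g, MonoidAlgebra.single g⁻¹ (f g)
  have key : ∀ S : Submodule ℂ[H] ℂ[H], IsSimpleModule ℂ[H] S → ∀ s ∈ S, a * s = 0 := by
    intro S hS s hs
    let ρ : Representation ℂ H S := Representation.ofModule' S
    have hsmul : ∀ (r : ℂ[H]) (x : S), ρ.asAlgebraHom r x = r • x := fun r x => by
      have : ρ.asAlgebraHom = Algebra.lsmul ℂ ℂ S :=
        (MonoidAlgebra.lift ℂ (S →ₗ[ℂ] S) H).apply_symm_apply _
      rw [this]; rfl
    have e : ρ.asModule ≃ₗ[ℂ[H]] S :=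
      { ρ.asModuleEquiv.toAddEquiv with
        map_smul' := fun r x => (ρ.asModuleEquiv_map_smul r x).trans (hsmul r _) }
    have : ρ.IsIrreducible := (Representation.irreducible_iff_isSimpleModule_asModule ρ).2
      (IsSimpleModule.congr e)
    have : FiniteDimensional ℂ S := inferInstanceAs (FiniteDimensional ℂ (S.restrictScalars ℂ))
    have h1 := LinearMap.congr_fun (sum_smul_rep_eq_zero ρ f hf h0) ⟨s, hs⟩
    have h2 : ρ.asAlgebraHom a = ∑ g, f g • ρ g⁻¹ := by
      simp [a, map_sum]
    rw [← h2, hsmul] at h1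
    exact congrArg Subtype.val h1
  have hcomm : ∀ b : ℂ[H], a * b = b * a := by
    intro b
    induction b using MonoidAlgebra.induction_on with
    | of h =>
      simp only [a, MonoidAlgebra.of_apply, Finset.sum_mul, Finset.mul_sum,
        MonoidAlgebra.single_mul_single, mul_one, one_mul]
      refine Fintype.sum_equiv (MulAut.conj h⁻¹).toEquiv _ _ fun g => ?_
      have : f ((MulAut.conj h⁻¹).toEquiv g) = f g := by simpa using hf g h⁻¹
      rw [this]
      congr 1
      simp [mul_assoc]
    | add x y hx hy => rw [mul_add, add_mul, hx, hy]
    | smul r x hx => rw [mul_smul_comm, smul_mul_assoc, hx]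
  have hle : sSup {S : Submodule ℂ[H] ℂ[H] | IsSimpleModule ℂ[H] S} ≤
      LinearMap.ker (LinearMap.toSpanSingleton ℂ[H] ℂ[H] a) :=
    sSup_le fun S hS s hs => by
      simp [← hcomm, key S hS s hs]
  rw [IsSemisimpleModule.sSup_simples_eq_top] at hle
  have ha : a = 0 := by simpa using hle (Submodule.mem_top (x := (1 : ℂ[H])))
  funext g
  classical
  have := congrArg (fun b : ℂ[H] => b.coeff g⁻¹) ha
  simpa [a, MonoidAlgebra.coeff_sum, Finsupp.single_apply] using this
end

section
variable {H : Type u} [Group H] [Finite H]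

/-- A class function is a linear combination of irreducible characters in exactly one way. -/
theorem existsUnique_irrChar_expansion (f : H → ℂ) (hf : ∀ g h, f (h * g * h⁻¹) = f g) :
    ∃! b : irrChar H → ℂ, ∀ g, f g = ∑ᶠ χ : irrChar H, b χ * (χ : H → ℂ) g := by
  classical
  have := Fintype.ofFinite H
  have := Fintype.ofFinite (irrChar H)
  simp only [finsum_eq_sum_of_fintype]
  refine ⟨fun χ => (Nat.card H : ℂ)⁻¹ * ∑ g, f g * (χ : H → ℂ) g⁻¹, ?_, ?_⟩
  · set b : irrChar H → ℂ := fun χ => (Nat.card H : ℂ)⁻¹ * ∑ g, f g * (χ : H → ℂ) g⁻¹ with hb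
    have hN : (Nat.card H : ℂ) ≠ 0 := by simp [Nat.card_eq_fintype_card]
    have h0 : (fun g => f g - ∑ χ : irrChar H, b χ * (χ : H → ℂ) g) = 0 := by
      refine classFun_eq_zero _ (fun g h => ?_) fun ψ hψ => ?_
      · simp only [hf, irrChar_conj (Subtype.property _)]
      · refine (mul_eq_zero_iff_left (inv_ne_zero hN)).1 ?_
        simp only [sub_mul, Finset.sum_sub_distrib, mul_sub, Finset.sum_mul]
        rw [Finset.sum_comm]
        have h1 : (Nat.card H : ℂ)⁻¹ * ∑ χ : irrChar H, ∑ g, b χ * (χ : H → ℂ) g * ψ g⁻¹ =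
            ∑ χ : irrChar H, b χ * ((Nat.card H : ℂ)⁻¹ * ∑ g, (χ : H → ℂ) g * ψ g⁻¹) := by
          simp only [Finset.mul_sum]
          exact Finset.sum_congr rfl fun χ _ => Finset.sum_congr rfl fun g _ => by ring
        rw [h1]
        simp only [irrChar_orthonormal (Subtype.property _) hψ]
        have h2 : ∀ χ : irrChar H, ((χ : H → ℂ) = ψ) ↔ χ = ⟨ψ, hψ⟩ := fun χ =>
          ⟨fun e => Subtype.ext e, fun e => by rw [e]⟩
        simp [h2, hb]
    intro g
    exact sub_eq_zero.1 (congrFun h0 g)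
  · intro b hb
    have hN : (Nat.card H : ℂ) ≠ 0 := by simp [Nat.card_eq_fintype_card]
    funext ψ
    simp only [hb, Finset.sum_mul]
    rw [Finset.sum_comm]
    have h1 : (Nat.card H : ℂ)⁻¹ * ∑ χ : irrChar H, ∑ g, b χ * (χ : H → ℂ) g * (ψ : H → ℂ) g⁻¹ =
        ∑ χ : irrChar H, b χ * ((Nat.card H : ℂ)⁻¹ * ∑ g, (χ : H → ℂ) g * (ψ : H → ℂ) g⁻¹) := by
      simp only [Finset.mul_sum]
      exact Finset.sum_congr rfl fun χ _ => Finset.sum_congr rfl fun g _ => by ring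
    rw [h1]
    simp only [irrChar_orthonormal (Subtype.property _) ψ.property]
    simp [Subtype.coe_inj]

end

section
variable {G : Type u} [Group G]

/-- The function `γ_m^z(g) = |G_m(g, z)|` on `C_G(z)`, where
`G_m(g, z) = {x ∈ G | x ^ m = (g x) ^ m = z}`. -/
noncomputable def gammaFun (m : ℕ) (z : G) (g : Subgroup.centralizer {z}) : ℂ :=
  Nat.card {x : G // x ^ m = z ∧ ((g : G) * x) ^ m = z}

theorem gammaFun_conj (m : ℕ) (z : G) (g h : Subgroup.centralizer {z}) :
    gammaFun m z (h * g * h⁻¹) = gammaFun m z g := by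
  unfold gammaFun
  congr 1
  have aux : ∀ a c w : G, a * c = c * a → (a * w * a⁻¹ = c ↔ w = c) := fun a c w hac => by
    rw [mul_inv_eq_iff_eq_mul, ← hac, mul_right_inj]
  have hz' : ∀ w : G, (h : G) * w * (h : G)⁻¹ = z ↔ w = z := fun w =>
    aux _ _ _ (Subgroup.mem_centralizer_singleton_iff.1 h.2)
  refine (Nat.card_congr ((MulAut.conj (h : G)).toEquiv.subtypeEquiv fun x => ?_)).symm
  have e1 : (MulAut.conj (h : G)).toEquiv x = h * x * (h : G)⁻¹ := rfl
  have e2 : ((h * g * h⁻¹ : Subgroup.centralizer {z}) : G) * (h * x * (h : G)⁻¹) =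
      h * (g * x) * (h : G)⁻¹ := by
    push_cast
    group
  rw [e1, e2, conj_pow, conj_pow, hz', hz']

variable [Finite G]

/-- `β_m(z, χ)`, the coefficient of `χ ∈ Irr(C_G(z))` in the expansion
`γ_m^z = ∑_{χ ∈ Irr(C_G(z))} β_m(z, χ) χ`. -/
noncomputable def beta (m : ℕ) (z : G) : irrChar (Subgroup.centralizer {z}) → ℂ :=
  (existsUnique_irrChar_expansion (gammaFun m z) (gammaFun_conj m z)).choose

theorem gammaFun_eq_sum_beta (m : ℕ) (z : G) (g : Subgroup.centralizer {z}) :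
    gammaFun m z g =
      ∑ᶠ χ : irrChar (Subgroup.centralizer {z}), beta m z χ * (χ : _ → ℂ) g :=
  (existsUnique_irrChar_expansion (gammaFun m z) (gammaFun_conj m z)).choose_spec.1 g

end

theorem irrChar_comp {H K : Type u} [Group H] [Group K] (e : K ≃* H) {χ : H → ℂ}
    (hχ : χ ∈ irrChar H) : (fun x => χ (e x)) ∈ irrChar K := by
  obtain ⟨V, _, _, _, ρ, hρ, rfl⟩ := hχ
  refine ⟨V, _, _, inferInstance, ρ.comp e.toMonoidHom, ?_, rfl⟩
  let o : Subrepresentation (ρ.comp e.toMonoidHom) ≃o Subrepresentation ρ :=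
    { toFun := fun S => ⟨S.toSubmodule, fun g v hv => by
        simpa using S.apply_mem_toSubmodule (e.symm g) hv⟩
      invFun := fun S => ⟨S.toSubmodule, fun g v hv => S.apply_mem_toSubmodule (e g) hv⟩
      left_inv := fun S => rfl
      right_inv := fun S => rfl
      map_rel_iff' := Iff.rfl }
  exact o.isSimpleOrder_iff.2 hρ

/-- For central `z` one has `C_G(z) = G`; this is `χ ∈ Irr(G)` seen as an element of
`Irr(C_G(z))`. -/
def irrCharRestrict {G : Type u} [Group G] {z : G} (hz : z ∈ Subgroup.center G)
    (χ : irrChar G) : irrChar (Subgroup.centralizer {z}) :=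
  ⟨fun g => (χ : G → ℂ) g,
    irrChar_comp ((MulEquiv.subgroupCongr (Subgroup.centralizer_eq_top_iff_subset.2
      (Set.singleton_subset_iff.2 hz))).trans Subgroup.topEquiv) χ.property⟩

/-- `z` is a `p`-element: its order is a power of `p` (possibly `1`). -/
def IsPElement {G : Type u} [Group G] (p : ℕ) (z : G) : Prop := ∃ j : ℕ, orderOf z = p ^ j

/-- `u` is the `p`-part of `y`: `y = u w` with commuting `u`, `w`, where `u` is a `p`-element and
the order of `w` is prime to `p`. -/
def IsPPart {G : Type u} [Group G] (p : ℕ) (y u : G) : Prop :=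
  IsPElement p u ∧ ∃ w : G, Commute u w ∧ u * w = y ∧ (orderOf w).Coprime p

theorem IsPPart.mem_zpowers {G : Type u} [Group G] {p : ℕ} {y u : G} (h : IsPPart p y u) :
    u ∈ Subgroup.zpowers y := by
  obtain ⟨⟨j, hj⟩, w, hc, rfl, hw⟩ := h
  have hco : (orderOf u).Coprime (orderOf w) := by rw [hj]; exact (hw.pow_right j).symm
  obtain ⟨N, hN1, hN2⟩ := Nat.chineseRemainder hco 1 0
  refine ⟨(N : ℤ), ?_⟩
  have h1 : u ^ N = u := by simpa using pow_eq_pow_iff_modEq.2 hN1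
  have h2 : w ^ N = 1 := by simpa using pow_eq_pow_iff_modEq.2 hN2
  simp [hc.mul_pow, h1, h2]

theorem IsPPart.mem_center {G : Type u} [Group G] {p : ℕ} {y u : G} (h : IsPPart p y u)
    (hy : y ∈ Subgroup.center G) : u ∈ Subgroup.center G :=
  Subgroup.zpowers_le.2 hy h.mem_zpowers

end FSZ

/-! Everything is reduced to counting: `powCount m a z` is the number of x with x^m = (ax)^m = z.
The bridge is `isFSZ_iff_powCount_pow`: G is FSZ_m exactly when, for commuting a and y, the count at
(a, y) does not change when y is replaced by y^n with n prime to |G|.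

If all indicators are integers, let D(G) act on functions on G with g placed in degree g a g⁻¹.
Right translation by y⁻¹ is an endomorphism, and its eigenspaces are submodules with integral
indicators t_k. The trace of Λ₍₁₎⋯Λ₍ₘ₎ composed with the j-th power of this translation is the count
at (a, y^j), so this count equals ∑ t_k ζ^(kj). At j = 1 it is an integer, and Galois conjugation ζ
↦ ζ^n preserves integers.

Conversely, |G| ν_m(V) is the sum of the counts at (b, w⁻¹) times the traces of e_b w. Conjugation
turns the trace of e_b w into that of e_b w^n, so invariant counts make ν_m(V) rational. It is also
an algebraic integer (`isIntegral_nu`), being the trace of a cyclic shift of tensor factors times a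
commuting projection. Hence it is an integer.

With q = p^k, two remarks on counts finish the proof. All solutions x commute with z = x^q, so
counts may be computed in any subgroup containing C_G(z) (`powCount_coe`). For central v, x ↦ xv
shows that the counts at u and u v^q agree (`powCount_mul_pow_of_mem_center`), and an element of
order prime to p is a q-th power of one of its own powers. So if p divides the order of y, the
criterion at y follows from the centralizer of a power of y of order p; otherwise y and y^n both
have the same count as 1 inside C_G(y). For central y, removing the part of order prime to p leaves
the counts, hence the β, unchanged. -/

namespace FSZ

/-! ### Solution counts. -/

/-- The number of `x ∈ G` such that `x ^ m = (a x) ^ m = z`. -/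
noncomputable def powCount {G : Type u} [Group G] (m : ℕ) (a z : G) : ℕ :=
  Nat.card {x : G // x ^ m = z ∧ (a * x) ^ m = z}

/-- A solution x makes z a power of both x and ax, so z commutes with their quotient a. -/
theorem commute_of_powCount_ne_zero {G : Type u} [Group G] {m : ℕ} {a z : G}
    (h : powCount m a z ≠ 0) : Commute z a := by
  obtain ⟨⟨x, hx, hax⟩⟩ := (Nat.card_ne_zero.1 h).1
  have h1 : Commute z x := by rw [← hx]; exact Commute.pow_self x m
  have h2 : Commute z (a * x) := by nth_rewrite 1 [← hax]; exact Commute.pow_self _ m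
  simpa using h2.mul_right h1.inv_right

theorem powCount_conj {G : Type u} [Group G] (m : ℕ) (g a z : G) :
    powCount m (g * a * g⁻¹) (g * z * g⁻¹) = powCount m a z := by
  refine (Nat.card_congr ((MulAut.conj g).toEquiv.subtypeEquiv fun x => ?_)).symm
  have e1 : (MulAut.conj g).toEquiv x = g * x * g⁻¹ := rfl
  have e2 : g * a * g⁻¹ * (g * x * g⁻¹) = g * (a * x) * g⁻¹ := by group
  rw [e1, e2, conj_pow, conj_pow]
  simp

/-! ### Sweedler powers of the integral of D(G). -/

section DoubleCalculus

open DrinfeldDouble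

variable {G : Type u} [Group G] [Fintype G] [DecidableEq G]

theorem sweedlerPower_zero (a : DrinfeldDouble G) :
    sweedlerPower (DrinfeldDouble G) 0 a = Coalgebra.counit (R := ℂ) a • 1 := by
  rw [sweedlerPower, pow_zero, LinearMap.convOne_def, Algebra.smul_def, mul_one]
  rfl

theorem sweedlerPower_succ_basis (m : ℕ) (g x : G) :
    sweedlerPower (DrinfeldDouble G) (m + 1) (basis (g, x)) =
      ∑ h : G, basis (h, x) * sweedlerPower (DrinfeldDouble G) m (basis (h⁻¹ * g, x)) := by
  rw [sweedlerPower, pow_succ']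
  change ((_ : WithConv (DrinfeldDouble G →ₗ[ℂ] DrinfeldDouble G)) * _) _ = _
  rw [LinearMap.convMul_apply, comul_basis, map_sum, map_sum]
  rfl

/-- A product e_{a₁}x ⋯ e_{aₘ}x survives only if each a_{i+1} is x⁻¹ a_i x. The degrees are then
determined by a = a₁, and their product telescopes to (a x⁻¹)^m x^m. -/
theorem sweedlerPower_basis (m : ℕ) (g x : G) :
    sweedlerPower (DrinfeldDouble G) m (basis (g, x)) =
      ∑ a : G, if (a * x⁻¹) ^ m * x ^ m = g then basis (a, x ^ m) else 0 := by
  induction m generalizing g with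
  | zero =>
    rw [sweedlerPower_zero, counit_basis, one_eq_sum]
    simp only [pow_zero, mul_one, eq_comm (a := (1 : G))]
    split_ifs <;> simp
  | succ m ih =>
    rw [sweedlerPower_succ_basis]
    refine Finset.sum_congr rfl fun h _ => ?_
    rw [ih, Finset.mul_sum, Finset.sum_eq_single (x⁻¹ * h * x)]
    · have e1 : (x⁻¹ * h * x * x⁻¹) ^ m * x ^ m = x⁻¹ * ((h * x⁻¹) ^ m * x ^ (m + 1)) := by
        have : x⁻¹ * h * x * x⁻¹ = x⁻¹ * (h * x⁻¹) * (x⁻¹)⁻¹ := by group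
        rw [this, conj_pow, pow_succ' x m]
        group
      have e2 : x⁻¹ * ((h * x⁻¹) ^ m * x ^ (m + 1)) = h⁻¹ * g ↔
          (h * x⁻¹) ^ (m + 1) * x ^ (m + 1) = g := by
        rw [eq_inv_mul_iff_mul_eq, pow_succ' (h * x⁻¹) m]
        simp only [mul_assoc]
      have e3 : h = x * (x⁻¹ * h * x) * x⁻¹ := by group
      rw [e1]
      simp only [e2]
      split_ifs
      · rw [basis_mul_basis, if_pos e3, ← pow_succ']
      · rw [mul_zero]
    · intro b _ hb
      have : ¬ h = x * b * x⁻¹ := fun e => hb (by rw [e]; group)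
      split_ifs
      · rw [basis_mul_basis, if_neg this]
      · rw [mul_zero]
    · simp

/-- The element `Λ₍₁₎ ⋯ Λ₍ₘ₎` in terms of solution counts. -/
theorem sweedlerPower_integral_apply (m : ℕ) (b w : G) :
    sweedlerPower (DrinfeldDouble G) m integral (b, w) =
      (Fintype.card G : ℂ)⁻¹ * powCount m b w⁻¹ := by
  rw [integral, map_smul, map_sum, smul_apply]
  congr 1
  have hs : ∀ {ι : Type u} (s : Finset ι) (f : ι → DrinfeldDouble G) (r : G × G),
      (∑ i ∈ s, f i) r = ∑ i ∈ s, f i r := fun s f r => Finset.sum_apply r s f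
  rw [hs]
  have h1 : ∀ x : G, sweedlerPower (DrinfeldDouble G) m (basis (1, x)) (b, w) =
      if x⁻¹ ^ m = w⁻¹ ∧ (b * x⁻¹) ^ m = w⁻¹ then 1 else 0 := by
    intro x
    have e : ((b * x⁻¹) ^ m * x ^ m = 1 ∧ w = x ^ m) ↔
        (x⁻¹ ^ m = w⁻¹ ∧ (b * x⁻¹) ^ m = w⁻¹) := by
      rw [inv_pow, inv_inj, mul_eq_one_iff_eq_inv]
      constructor
      · rintro ⟨h, rfl⟩; exact ⟨rfl, h⟩
      · rintro ⟨rfl, h⟩; exact ⟨h, rfl⟩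
    rw [sweedlerPower_basis, hs, Finset.sum_eq_single b]
    · rw [← if_congr e rfl rfl]
      split_ifs <;> simp_all [basis_apply]
    · intro a _ ha
      split_ifs
      · simp [basis_apply, ha.symm]
      · rfl
    · simp
  simp only [h1, powCount]
  rw [Finset.sum_boole, Nat.card_eq_fintype_card, Fintype.card_subtype]
  congr 1
  -- The summand e_1 x of Λ corresponds to the solution x⁻¹.
  refine Finset.card_equiv (Equiv.inv G) fun x => ?_
  simp

theorem sweedlerPower_integral (m : ℕ) :
    sweedlerPower (DrinfeldDouble G) m integral =
      (Fintype.card G : ℂ)⁻¹ • ∑ b : G, ∑ w : G, (powCount m b w⁻¹ : ℂ) • basis (b, w) := by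
  have := (basis (G := G)).sum_repr (sweedlerPower (DrinfeldDouble G) m integral)
  rw [← this, Fintype.sum_prod_type, Finset.smul_sum]
  refine Finset.sum_congr rfl fun b _ => ?_
  rw [Finset.smul_sum]
  refine Finset.sum_congr rfl fun w _ => ?_
  rw [smul_smul, ← sweedlerPower_integral_apply]
  rfl

end DoubleCalculus

/-! ### Galois conjugation of roots of unity. -/

section CyclotomicArithmetic

open Polynomial

/-- An integer value of an integral polynomial at a primitive root of unity is also its value at
the conjugate roots of unity. -/
theorem aeval_pow_eq_of_aeval_eq_int {N : ℕ} (hN : 0 < N) {ζ : ℂ} (hζ : IsPrimitiveRoot ζ N)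
    {n : ℕ} (hn : n.Coprime N) (P : ℤ[X]) (c : ℤ) (h : aeval ζ P = c) :
    aeval (ζ ^ n) P = c := by
  have h1 : aeval ζ (P - C c) = 0 := by simp [h]
  have h2 : minpoly ℤ (ζ ^ n) ∣ P - C c := by
    rw [← hζ.minpoly_eq_pow_coprime hn]
    exact minpoly.isIntegrallyClosed_dvd (hζ.isIntegral hN) h1
  have h3 := aeval_eq_zero_of_dvd_aeval_eq_zero h2 (minpoly.aeval ℤ (ζ ^ n))
  simpa [sub_eq_zero] using h3

/-- A rational polynomial with equal values at all primitive `N`-th roots of unity has a rational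
value there. -/
theorem exists_rat_of_aeval_pow_eq {N : ℕ} [NeZero N] {ζ : ℂ} (hζ : IsPrimitiveRoot ζ N)
    (P : ℚ[X]) (h : ∀ n : ℕ, n.Coprime N → aeval (ζ ^ n) P = aeval ζ P) :
    ∃ r : ℚ, aeval ζ P = r := by
  let K := IntermediateField.adjoin ℚ {ζ}
  have hK : IsCyclotomicExtension {N} ℚ K :=
    (IntermediateField.isCyclotomicExtension_singleton_iff_eq_adjoin N ℚ ℂ K hζ).mpr rfl
  have := IsCyclotomicExtension.isGalois {N} ℚ K
  have : FiniteDimensional ℚ K := IsCyclotomicExtension.finiteDimensional {N} ℚ K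
  let z : K := ⟨ζ, IntermediateField.mem_adjoin_simple_self ℚ ζ⟩
  have hz : IsPrimitiveRoot z N :=
    IsPrimitiveRoot.of_map_of_injective (f := algebraMap K ℂ) hζ (algebraMap K ℂ).injective
  have hval : ∀ w : K, ((aeval w P : K) : ℂ) = aeval (w : ℂ) P := fun w =>
    (aeval_algebraMap_apply ℂ w P).symm
  -- Each automorphism of the cyclotomic field sends ζ to a coprime power, so the hypothesis says
  -- that the value is Galois-fixed.
  obtain ⟨r, hr⟩ := (IsGalois.mem_range_algebraMap_iff_fixed (F := ℚ) (aeval z P)).2 fun f => by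
    rw [← aeval_algHom_apply]
    obtain ⟨n, -, hn, hfn⟩ := hz.isPrimitiveRoot_iff.1 (hz.map_of_injective f.injective)
    rw [← hfn]
    apply Subtype.ext
    rw [hval, hval]
    exact h n hn
  refine ⟨r, ?_⟩
  rw [← hval z, ← hr]
  rfl

theorem exists_int_of_isIntegral_of_rat {x : ℂ} (hx : IsIntegral ℤ x) {r : ℚ} (hr : x = r) :
    ∃ n : ℤ, x = n := by
  subst hr
  have h1 : IsIntegral ℤ r :=
    (isIntegral_algebraMap_iff (algebraMap ℚ ℂ).injective).1 hx
  obtain ⟨n, rfl⟩ := IsIntegrallyClosed.isIntegral_iff.1 h1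
  exact ⟨n, by simp⟩

end CyclotomicArithmetic

/-! ### Spectral projections of an element of finite order. -/

section Spectral

variable {A : Type*} [Ring A] [Algebra ℂ A]

/-- The projection onto the `ζ ^ k`-eigenspace of an element `R` with `R ^ N = 1`. -/
noncomputable def spectralProj (N : ℕ) (ζ : ℂ) (R : A) (k : ℕ) : A :=
  (N : ℂ)⁻¹ • ∑ j ∈ Finset.range N, (ζ⁻¹ ^ (k * j)) • R ^ j

variable {N : ℕ} {ζ : ℂ} {R : A}

theorem commute_spectralProj {M : A} (h : Commute M R) (k : ℕ) :
    Commute M (spectralProj N ζ R k) :=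
  (Commute.sum_right _ _ _ fun _ _ => (h.pow_right _).smul_right _).smul_right _

theorem mul_spectralProj (hN : 0 < N) (hζ : IsPrimitiveRoot ζ N) (hR : R ^ N = 1) (k : ℕ) :
    R * spectralProj N ζ R k = ζ ^ k • spectralProj N ζ R k := by
  have hζ0 : ζ ≠ 0 := hζ.ne_zero hN.ne'
  rw [spectralProj, mul_smul_comm, smul_comm (ζ ^ k) (N : ℂ)⁻¹, Finset.mul_sum]
  congr 1
  rw [Finset.smul_sum]
  let f : ℕ → A := fun j => ζ ^ k • (ζ⁻¹ ^ (k * j)) • R ^ j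
  have h1 : ∀ j, R * ((ζ⁻¹ ^ (k * j)) • R ^ j) = f (j + 1) := fun j => by
    simp only [f]
    rw [mul_smul_comm, ← pow_succ', smul_smul, mul_add, mul_one, pow_add ζ⁻¹, mul_left_comm,
      ← mul_pow, mul_inv_cancel₀ hζ0, one_pow, mul_one]
  -- Multiplication by R shifts the summation index by one; periodicity of the summand closes the
  -- cycle.
  have h2 : f N = f 0 := by
    simp only [f, hR, mul_zero, pow_zero]
    rw [mul_comm k, pow_mul, inv_pow, hζ.pow_eq_one, inv_one, one_pow]
  simp only [h1]
  have h3 := Finset.sum_range_succ f N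
  have h4 := Finset.sum_range_succ' f N
  rw [h3, h2] at h4
  exact (add_right_cancel h4).symm

theorem pow_mul_spectralProj (hN : 0 < N) (hζ : IsPrimitiveRoot ζ N) (hR : R ^ N = 1) (k i : ℕ) :
    R ^ i * spectralProj N ζ R k = ζ ^ (k * i) • spectralProj N ζ R k := by
  induction i with
  | zero => simp
  | succ i ih =>
    rw [pow_succ, mul_assoc, mul_spectralProj hN hζ hR, mul_smul_comm, ih, smul_smul, ← pow_add]
    congr 2
    ring

theorem spectralProj_mul_self (hN : 0 < N) (hζ : IsPrimitiveRoot ζ N) (hR : R ^ N = 1) (k : ℕ) :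
    spectralProj N ζ R k * spectralProj N ζ R k = spectralProj N ζ R k := by
  have hζ0 : ζ ≠ 0 := hζ.ne_zero hN.ne'
  nth_rewrite 1 [spectralProj]
  rw [smul_mul_assoc, Finset.sum_mul]
  simp only [smul_mul_assoc, pow_mul_spectralProj hN hζ hR, smul_smul, ← mul_pow,
    inv_mul_cancel₀ hζ0, one_pow, one_smul]
  rw [Finset.sum_const, Finset.card_range, ← Nat.cast_smul_eq_nsmul ℂ, smul_smul,
    inv_mul_cancel₀ (by exact_mod_cast hN.ne'), one_smul]

theorem sum_spectralProj (hN : 0 < N) (hζ : IsPrimitiveRoot ζ N) :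
    ∑ k ∈ Finset.range N, spectralProj N ζ R k = 1 := by
  simp only [spectralProj]
  rw [← Finset.smul_sum, Finset.sum_comm]
  simp only [← Finset.sum_smul]
  rw [Finset.sum_eq_single 0]
  · simp [← Nat.cast_smul_eq_nsmul ℂ, smul_smul, hN.ne']
  · intro j hj hj0
    have h1 : ζ⁻¹ ^ j ≠ 1 := by
      rw [inv_pow, inv_ne_one]
      exact hζ.pow_ne_one_of_pos_of_lt hj0 (Finset.mem_range.1 hj)
    have h2 : ∑ k ∈ Finset.range N, ζ⁻¹ ^ (k * j) = 0 := by
      simp only [mul_comm _ j, pow_mul]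
      rw [geom_sum_eq h1, ← pow_mul, mul_comm, pow_mul, inv_pow, hζ.pow_eq_one]
      simp
    rw [h2, zero_smul]
  · intro h; simp [hN.ne'] at h

theorem pow_eq_sum_spectralProj (hN : 0 < N) (hζ : IsPrimitiveRoot ζ N) (hR : R ^ N = 1) (i : ℕ) :
    R ^ i = ∑ k ∈ Finset.range N, ζ ^ (k * i) • spectralProj N ζ R k := by
  rw [← mul_one (R ^ i), ← sum_spectralProj (R := R) hN hζ, Finset.mul_sum]
  exact Finset.sum_congr rfl fun k _ => pow_mul_spectralProj hN hζ hR k i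

end Spectral

/-! ### Traces: additivity, projections, integrality. -/

section Trace

theorem trace_eq_add_of_exact {V S Q : Type*} [AddCommGroup V] [Module ℂ V] [AddCommGroup S]
    [Module ℂ S] [AddCommGroup Q] [Module ℂ Q] [FiniteDimensional ℂ V] [FiniteDimensional ℂ S]
    [FiniteDimensional ℂ Q] (i : S →ₗ[ℂ] V) (p : V →ₗ[ℂ] Q) (hi : Function.Injective i)
    (hp : Function.Surjective p) (hip : Function.Exact i p)
    (M : V →ₗ[ℂ] V) (MS : S →ₗ[ℂ] S) (MQ : Q →ₗ[ℂ] Q) (h1 : M ∘ₗ i = i ∘ₗ MS)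
    (h2 : p ∘ₗ M = MQ ∘ₗ p) :
    LinearMap.trace ℂ V M = LinearMap.trace ℂ S MS + LinearMap.trace ℂ Q MQ := by
  obtain ⟨s, hs⟩ := p.exists_rightInverse_of_surjective (LinearMap.range_eq_top.2 hp)
  obtain ⟨r, hr⟩ := i.exists_leftInverse_of_injective (LinearMap.ker_eq_bot.2 hi)
  -- The section is corrected to be killed by the retraction `r`, so that `i ∘ₗ r` and `s' ∘ₗ p` are
  -- complementary projections.
  let s' : Q →ₗ[ℂ] V := s - i ∘ₗ r ∘ₗ s
  have hpi : p ∘ₗ i = 0 := hip.linearMap_comp_eq_zero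
  have hs' : p ∘ₗ s' = LinearMap.id := by
    rw [LinearMap.comp_sub, hs, ← LinearMap.comp_assoc, hpi, LinearMap.zero_comp, sub_zero]
  have hrs' : r ∘ₗ s' = 0 := by
    rw [LinearMap.comp_sub, ← LinearMap.comp_assoc _ _ r, hr, LinearMap.id_comp, sub_self]
  have hid : i ∘ₗ r + s' ∘ₗ p = LinearMap.id := by
    ext v
    obtain ⟨w, hw⟩ := (hip (v - s' (p v))).1 (by
      rw [map_sub, ← LinearMap.comp_apply p s', hs', LinearMap.id_apply, sub_self])
    have hv : v = i w + s' (p v) := by rw [hw]; abel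
    have hrv : r v = w := by
      rw [hv, map_add, ← LinearMap.comp_apply r i, hr, ← LinearMap.comp_apply r s', hrs']
      simp
    simp only [LinearMap.add_apply, LinearMap.comp_apply, LinearMap.id_apply, hrv]
    exact hv.symm
  have hM : M = (M ∘ₗ i) ∘ₗ r + (M ∘ₗ s') ∘ₗ p := by
    rw [LinearMap.comp_assoc, LinearMap.comp_assoc, ← LinearMap.comp_add, hid, LinearMap.comp_id]
  have e1 : r ∘ₗ M ∘ₗ i = MS := by
    rw [h1, ← LinearMap.comp_assoc, hr, LinearMap.id_comp]
  have e2 : p ∘ₗ M ∘ₗ s' = MQ := by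
    rw [← LinearMap.comp_assoc, h2, LinearMap.comp_assoc, hs', LinearMap.comp_id]
  rw [← e1, ← e2, ← LinearMap.trace_comp_comm' r (M ∘ₗ i), ← LinearMap.trace_comp_comm' p,
    ← map_add]
  exact congrArg _ hM

/-- The trace of an endomorphism followed by a commuting projection. -/
theorem trace_mul_proj {V S : Type*} [AddCommGroup V] [Module ℂ V] [AddCommGroup S]
    [Module ℂ S] [FiniteDimensional ℂ V] [FiniteDimensional ℂ S] (i : S →ₗ[ℂ] V)
    (r : V →ₗ[ℂ] S) (hr : r ∘ₗ i = LinearMap.id) (M : V →ₗ[ℂ] V) (MS : S →ₗ[ℂ] S)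
    (h : M ∘ₗ i = i ∘ₗ MS) :
    LinearMap.trace ℂ V (M ∘ₗ i ∘ₗ r) = LinearMap.trace ℂ S MS := by
  rw [← LinearMap.comp_assoc, LinearMap.trace_comp_comm', h, ← LinearMap.comp_assoc, hr,
    LinearMap.id_comp]

theorem exists_nat_trace_of_mul_self {V : Type*} [AddCommGroup V] [Module ℂ V]
    [FiniteDimensional ℂ V] {e : V →ₗ[ℂ] V} (he : e * e = e) :
    ∃ n : ℕ, LinearMap.trace ℂ V e = n :=
  ⟨_, (LinearMap.IsIdempotentElem.isProj_range e he).trace⟩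

open Polynomial in
/-- Matrices with `M ^ (m + 1) = M`, `m ≥ 1`, have integral trace. -/
theorem isIntegral_trace_of_pow_succ_eq {ι : Type*} [Fintype ι] [DecidableEq ι]
    {M : Matrix ι ι ℂ} {m : ℕ} (hm : 0 < m) (h : M ^ (m + 1) = M) : IsIntegral ℤ M.trace := by
  rw [Matrix.trace_eq_sum_roots_charpoly]
  refine IsIntegral.multiset_sum fun r hr => ?_
  have h1 : r ∈ spectrum ℂ M :=
    Matrix.mem_spectrum_iff_isRoot_charpoly.2 (isRoot_of_mem_roots hr)
  have h2 := spectrum.subset_polynomial_aeval M (X ^ (m + 1) - X : ℂ[X]) ⟨r, h1, rfl⟩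
  have h3 : r ^ (m + 1) - r = 0 := by
    have : Nontrivial (Matrix ι ι ℂ) := by
      by_contra hc
      rw [not_nontrivial_iff_subsingleton] at hc
      simp [spectrum.of_subsingleton] at h1
    simpa [h] using h2
  refine ⟨X ^ (m + 1) - X, ?_, by simp [h3]⟩
  exact monic_X_pow_sub (by simpa using by exact_mod_cast Nat.succ_lt_succ hm)

end Trace

/-! ### From integral indicators to invariant counts. -/

section ModulesOfDouble

open DrinfeldDouble

variable {G : Type u} [Group G] [Fintype G] [DecidableEq G]

theorem nu_eq_add_of_submodule (m : ℕ) (V : Type u) [AddCommGroup V] [Module ℂ V]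
    [Module (DrinfeldDouble G) V] [IsScalarTower ℂ (DrinfeldDouble G) V] [FiniteDimensional ℂ V]
    (S : Submodule (DrinfeldDouble G) V) : nu G m V = nu G m S + nu G m (V ⧸ S) := by
  have : FiniteDimensional ℂ S := inferInstanceAs (FiniteDimensional ℂ (S.restrictScalars ℂ))
  have : FiniteDimensional ℂ (V ⧸ S) :=
    Module.Finite.of_surjective (S.mkQ.restrictScalars ℂ) S.mkQ_surjective
  refine trace_eq_add_of_exact (S.subtype.restrictScalars ℂ) (S.mkQ.restrictScalars ℂ)
    S.subtype_injective S.mkQ_surjective ?_ _ _ _ ?_ ?_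
  · exact LinearMap.exact_subtype_mkQ S
  · rfl
  · rfl

/-- If all simple modules have integral indicators, so have all finite-dimensional modules. -/
theorem exists_int_nu_of_forall_simple {m : ℕ}
    (H : ∀ (V : Type u) [AddCommGroup V] [Module ℂ V] [Module (DrinfeldDouble G) V]
      [IsScalarTower ℂ (DrinfeldDouble G) V] [IsSimpleModule (DrinfeldDouble G) V],
      ∃ n : ℤ, nu G m V = n)
    (V : Type u) [AddCommGroup V] [Module ℂ V] [Module (DrinfeldDouble G) V]
    [IsScalarTower ℂ (DrinfeldDouble G) V] [FiniteDimensional ℂ V] :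
    ∃ n : ℤ, nu G m V = n := by
  induction hd : Module.finrank ℂ V using Nat.strong_induction_on generalizing V with
  | _ d ih =>
    subst hd
    by_cases hs : IsSimpleModule (DrinfeldDouble G) V
    · exact H V
    rcases subsingleton_or_nontrivial V with hV | hV
    · refine ⟨0, ?_⟩
      rw [nu, Subsingleton.elim (Algebra.lsmul ℂ ℂ V _) 0, map_zero, Int.cast_zero]
    obtain ⟨S, hS0, hS1⟩ : ∃ S : Submodule (DrinfeldDouble G) V, S ≠ ⊥ ∧ S ≠ ⊤ := by
      by_contra! hc
      exact hs ((isSimpleModule_iff _ _).2 ⟨fun S => or_iff_not_imp_left.2 (hc S)⟩)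
    have : FiniteDimensional ℂ S := inferInstanceAs (FiniteDimensional ℂ (S.restrictScalars ℂ))
    have : FiniteDimensional ℂ (V ⧸ S) :=
      Module.Finite.of_surjective (S.mkQ.restrictScalars ℂ) S.mkQ_surjective
    have h1 : Module.finrank ℂ S < Module.finrank ℂ V :=
      Submodule.finrank_lt (s := S.restrictScalars ℂ) (by simpa using hS1)
    have h2 : Module.finrank ℂ (V ⧸ S) + Module.finrank ℂ S = Module.finrank ℂ V :=
      (S.restrictScalars ℂ).finrank_quotient_add_finrank
    have h3 : 0 < Module.finrank ℂ S := by
      have := Submodule.nontrivial_iff_ne_bot.2 hS0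
      exact Module.finrank_pos
    obtain ⟨n₁, hn₁⟩ := ih _ h1 S rfl
    obtain ⟨n₂, hn₂⟩ := ih _ (by omega) (V ⧸ S) rfl
    exact ⟨n₁ + n₂, by rw [nu_eq_add_of_submodule m V S, hn₁, hn₂, Int.cast_add]⟩

/-- The trace of `Λ₍₁₎ ⋯ Λ₍ₘ₎` on an eigenspace of a module endomorphism of finite order. -/
theorem exists_submodule_trace_spectralProj (m : ℕ) {N : ℕ} (hN : 0 < N) {ζ : ℂ}
    (hζ : IsPrimitiveRoot ζ N) {V : Type u} [AddCommGroup V] [Module ℂ V]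
    [Module (DrinfeldDouble G) V] [IsScalarTower ℂ (DrinfeldDouble G) V] [FiniteDimensional ℂ V]
    (ρ : Module.End (DrinfeldDouble G) V)
    (hρ : (LinearMap.restrictScalars ℂ ρ : Module.End ℂ V) ^ N = 1) (k : ℕ) :
    ∃ S : Submodule (DrinfeldDouble G) V, LinearMap.trace ℂ V
      (Algebra.lsmul ℂ ℂ V (sweedlerPower (DrinfeldDouble G) m integral) *
        spectralProj N ζ (LinearMap.restrictScalars ℂ ρ : Module.End ℂ V) k) = nu G m S := by
  set R : Module.End ℂ V := LinearMap.restrictScalars ℂ ρ with hR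
  let S : Submodule (DrinfeldDouble G) V :=
    { carrier := {f | ρ f = ζ ^ k • f}
      add_mem' := fun {f f'} hf hf' => by
        change ρ (f + f') = _
        change ρ f = _ at hf
        change ρ f' = _ at hf'
        rw [map_add, hf, hf', smul_add]
      zero_mem' := by simp
      smul_mem' := fun d f hf => by
        change ρ (d • f) = _
        change ρ f = _ at hf
        rw [map_smul, hf, smul_algebra_smul_comm] }
  have : FiniteDimensional ℂ S := inferInstanceAs (FiniteDimensional ℂ (S.restrictScalars ℂ))
  let r : V →ₗ[ℂ] S :=
    { toFun := fun f => ⟨spectralProj N ζ R k f, LinearMap.congr_fun (mul_spectralProj hN hζ hρ k) f⟩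
      map_add' := fun f f' => Subtype.ext (map_add _ f f')
      map_smul' := fun c f => Subtype.ext (map_smul _ c f) }
  -- The spectral projection, with codomain restricted to the eigenspace, is a retraction onto it.
  refine ⟨S, trace_mul_proj (S.subtype.restrictScalars ℂ) r ?_ _ _ rfl⟩
  have hζ0 : ζ ≠ 0 := hζ.ne_zero hN.ne'
  ext ⟨f, hf⟩
  change spectralProj N ζ R k f = f
  have hpow : ∀ j, (R ^ j) f = ζ ^ (k * j) • f := fun j => by
    induction j with
    | zero => simp
    | succ j ih =>
      have hRf : R f = ζ ^ k • f := hf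
      rw [pow_succ, Module.End.mul_apply, hRf, map_smul, ih, smul_smul, ← pow_add]
      congr 2
      ring
  simp only [spectralProj, LinearMap.smul_apply, LinearMap.sum_apply, hpow, smul_smul, ← mul_pow,
    inv_mul_cancel₀ hζ0, one_pow, one_smul]
  rw [Finset.sum_const, Finset.card_range, ← Nat.cast_smul_eq_nsmul ℂ, smul_smul,
    inv_mul_cancel₀ (by exact_mod_cast hN.ne'), one_smul]

/-- The module over `D(G)` with basis `G` in which `g` has degree `g a g⁻¹` and `G` acts by left
translations; its elements are stored as functions on `G`. -/
def TranslationModule {G : Type u} (_a : G) : Type u := G → ℂ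

namespace TranslationModule

variable (a : G)

noncomputable instance : AddCommGroup (TranslationModule a) :=
  inferInstanceAs (AddCommGroup (G → ℂ))

noncomputable instance : Module ℂ (TranslationModule a) :=
  inferInstanceAs (Module ℂ (G → ℂ))

instance : FiniteDimensional ℂ (TranslationModule a) :=
  inferInstanceAs (FiniteDimensional ℂ (G → ℂ))

noncomputable instance : SMul (DrinfeldDouble G) (TranslationModule a) :=
  ⟨fun d f g => ∑ x : G, d (g * a * g⁻¹, x) * f (x⁻¹ * g)⟩

variable {a}

set_option linter.unusedSectionVars false in
theorem smul_apply (d : DrinfeldDouble G) (f : TranslationModule a) (g : G) :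
    (d • f) g = ∑ x : G, d (g * a * g⁻¹, x) * f (x⁻¹ * g) := rfl

set_option linter.unusedSectionVars false in
theorem add_apply (f f' : TranslationModule a) (g : G) : (f + f') g = f g + f' g := rfl

noncomputable instance : Module (DrinfeldDouble G) (TranslationModule a) where
  one_smul f := by
    funext g
    simp [smul_apply, one_apply]
  mul_smul d d' f := by
    funext g
    simp only [smul_apply, mul_apply, Finset.sum_mul, Finset.mul_sum]
    rw [Finset.sum_comm]
    refine Finset.sum_congr rfl fun x _ => ?_
    refine Fintype.sum_equiv (Equiv.mulLeft x⁻¹) _ _ fun w => ?_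
    simp [mul_assoc]
  smul_zero d := by
    funext g
    refine (smul_apply d 0 g).trans (Finset.sum_eq_zero fun x _ => ?_)
    exact mul_zero _
  smul_add d f f' := by
    funext g
    simp only [smul_apply, add_apply, mul_add, Finset.sum_add_distrib]
  add_smul d d' f := by
    funext g
    simp only [smul_apply, add_apply, DrinfeldDouble.add_apply, add_mul, Finset.sum_add_distrib]
  zero_smul f := by
    funext g
    refine (smul_apply 0 f g).trans (Finset.sum_eq_zero fun x _ => ?_)
    exact zero_mul _

instance : IsScalarTower ℂ (DrinfeldDouble G) (TranslationModule a) :=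
  ⟨fun c d f => by
    funext g
    refine Eq.trans ?_ (Finset.mul_sum _ _ _).symm
    exact Finset.sum_congr rfl fun x _ => mul_assoc _ _ _⟩

/-- Right translation by an element commuting with `a`. -/
noncomputable def rightTranslation {y : G} (h : Commute y a) :
    Module.End (DrinfeldDouble G) (TranslationModule a) where
  toFun f := fun g => f (g * y)
  map_add' _ _ := rfl
  map_smul' d f := by
    funext g
    simp only [smul_apply, RingHom.id_apply]
    -- The points g and gy have the same degree, so the translation respects the grading.
    have : g * y * a * (g * y)⁻¹ = g * a * g⁻¹ := by
      rw [mul_assoc g, h.eq]; group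
    rw [this]
    refine Finset.sum_congr rfl fun x _ => ?_
    rw [← mul_assoc]

theorem rightTranslation_pow_apply {y : G} (h : Commute y a) (n : ℕ) (f : TranslationModule a)
    (g : G) : (rightTranslation h ^ n) f g = f (g * y ^ n) := by
  induction n generalizing f with
  | zero => simp
  | succ n ih =>
    rw [pow_succ, Module.End.mul_apply, ih, pow_succ, ← mul_assoc]
    rfl

/-- The diagonal entry at g picks out the coefficient at (g a g⁻¹, g y g⁻¹). Conjugation invariance
of the counts makes all |G| entries equal, which cancels the factor |G|⁻¹ of the integral. -/
theorem trace_sweedlerPower_mul_translation (m : ℕ) {y : G}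
    (T : Module.End ℂ (TranslationModule a)) (hT : ∀ f g, T f g = f (g * y)) :
    LinearMap.trace ℂ (TranslationModule a)
      (Algebra.lsmul ℂ ℂ (TranslationModule a)
        (sweedlerPower (DrinfeldDouble G) m integral) * T) = powCount m a y⁻¹ := by
  let b : Module.Basis G ℂ (TranslationModule a) := Pi.basisFun ℂ G
  have hb : ∀ g k : G, b g k = if k = g then (1 : ℂ) else 0 := fun g k =>
    (congrFun (Pi.basisFun_apply ℂ G g) k).trans (Pi.single_apply _ _ _)
  rw [LinearMap.trace_eq_matrix_trace ℂ b, Matrix.trace]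
  have h1 : ∀ g : G, (LinearMap.toMatrix b b (Algebra.lsmul ℂ ℂ (TranslationModule a)
        (sweedlerPower (DrinfeldDouble G) m integral) * T)).diag g =
      (Fintype.card G : ℂ)⁻¹ * powCount m a y⁻¹ := by
    intro g
    rw [Matrix.diag_apply, LinearMap.toMatrix_apply]
    change (sweedlerPower (DrinfeldDouble G) m integral • T (b g)) g = _
    rw [smul_apply, Finset.sum_eq_single (g * y * g⁻¹)]
    · rw [hT, hb, if_pos (by group), mul_one, sweedlerPower_integral_apply]
      have : (g * y * g⁻¹)⁻¹ = g * y⁻¹ * g⁻¹ := by group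
      rw [this, powCount_conj]
    · intro x _ hx
      rw [hT, hb, if_neg, mul_zero]
      intro e
      apply hx
      have : x⁻¹ * (g * y) = g := by rw [← mul_assoc]; exact e
      rw [inv_mul_eq_iff_eq_mul] at this
      rw [this]; group
    · simp
  rw [Finset.sum_congr rfl fun g _ => h1 g, Finset.sum_const, Finset.card_univ, nsmul_eq_mul,
    ← mul_assoc, mul_inv_cancel₀ (by exact_mod_cast Fintype.card_ne_zero), one_mul]

end TranslationModule

open TranslationModule in
/-- Integrality of the indicators makes the solution counts invariant under prime powers. -/
theorem powCount_pow_of_forall_simple {m : ℕ}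
    (H : ∀ (V : Type u) [AddCommGroup V] [Module ℂ V] [Module (DrinfeldDouble G) V]
      [IsScalarTower ℂ (DrinfeldDouble G) V] [IsSimpleModule (DrinfeldDouble G) V],
      ∃ n : ℤ, nu G m V = n)
    {a y : G} (h : Commute y a) {n : ℕ} (hn : n.Coprime (Nat.card G)) :
    powCount m a (y ^ n) = powCount m a y := by
  -- Translating by y⁻¹ compensates for the inverse in the trace formula.
  have h' : Commute y⁻¹ a := h.inv_left
  have hN : 0 < Nat.card G := Nat.card_pos
  obtain ⟨ζ, hζ⟩ : ∃ ζ : ℂ, IsPrimitiveRoot ζ (Nat.card G) :=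
    ⟨_, Complex.isPrimitiveRoot_exp _ hN.ne'⟩
  let ρ := rightTranslation h'
  let R : Module.End ℂ (TranslationModule a) := ρ.restrictScalars ℂ
  let M : Module.End ℂ (TranslationModule a) := Algebra.lsmul ℂ ℂ (TranslationModule a)
    (sweedlerPower (DrinfeldDouble G) m integral)
  have hRpow : ∀ j f g, (R ^ j) f g = f (g * (y⁻¹) ^ j) := fun j f g => by
    rw [← rightTranslation_pow_apply h' j f g]
    have : R ^ j = (ρ ^ j).restrictScalars ℂ := by
      induction j with
      | zero => rfl
      | succ j ih => rw [pow_succ, ih, pow_succ]; rfl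
    rw [this]; rfl
  have hR : R ^ Nat.card G = 1 := by
    ext f
    funext g
    rw [hRpow, pow_card_eq_one', mul_one]
    rfl
  have htr : ∀ j, LinearMap.trace ℂ _ (M * R ^ j) = powCount m a (y ^ j) := fun j => by
    rw [trace_sweedlerPower_mul_translation m (R ^ j) (hRpow j), inv_pow, inv_inv]
  have hint : ∀ k, ∃ t : ℤ, LinearMap.trace ℂ _ (M * spectralProj (Nat.card G) ζ R k) = t := by
    intro k
    obtain ⟨S, hS⟩ := exists_submodule_trace_spectralProj m hN hζ ρ hR k
    have : FiniteDimensional ℂ S := inferInstanceAs (FiniteDimensional ℂ (S.restrictScalars ℂ))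
    obtain ⟨t, ht⟩ := exists_int_nu_of_forall_simple H S
    exact ⟨t, hS.trans ht⟩
  choose t ht using hint
  -- The coefficients are the indicators of the eigenspaces, so P(ζ^j) is the count at (a, y^j).
  let P : Polynomial ℤ := ∑ k ∈ Finset.range (Nat.card G), Polynomial.monomial k (t k)
  have hP : ∀ j, LinearMap.trace ℂ _ (M * R ^ j) = Polynomial.aeval (ζ ^ j) P := fun j => by
    rw [pow_eq_sum_spectralProj hN hζ hR, Finset.mul_sum, map_sum, map_sum]
    refine Finset.sum_congr rfl fun k _ => ?_
    rw [mul_smul_comm, map_smul, ht, Polynomial.aeval_monomial, ← pow_mul, mul_comm j k, smul_eq_mul,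
      mul_comm]
    rfl
  have h1 := aeval_pow_eq_of_aeval_eq_int hN hζ hn P (powCount m a y) (by
    have := htr 1
    rw [hP, pow_one, pow_one] at this
    rw [this]; simp)
  rw [← hP, htr] at h1
  exact_mod_cast h1

end ModulesOfDouble

/-! ### Cyclic permutation of tensor factors. -/

section CyclicTensors

variable {ι : Type*} [Fintype ι]

/-- The Kronecker product of a finite sequence of matrices. -/
noncomputable def tensorMatrix {n : ℕ} (A : Fin n → Matrix ι ι ℂ) :
    Matrix (Fin n → ι) (Fin n → ι) ℂ :=
  fun i j => ∏ k, A k (i k) (j k)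

theorem tensorMatrix_mul {n : ℕ} (A B : Fin n → Matrix ι ι ℂ) :
    tensorMatrix A * tensorMatrix B = tensorMatrix fun k => A k * B k := by
  ext i j
  simp only [Matrix.mul_apply, tensorMatrix, ← Finset.prod_mul_distrib]
  rw [Finset.prod_univ_sum, Fintype.piFinset_univ]

theorem tensorMatrix_eq_zero {ι : Type*} {n : ℕ} (A : Fin n → Matrix ι ι ℂ) {k : Fin n} (h : A k = 0) :
    tensorMatrix A = 0 := by
  ext i j
  exact Finset.prod_eq_zero (Finset.mem_univ k) (by simp [h])

variable [DecidableEq ι]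

/-- The action of a permutation of the tensor factors. -/
def factorPerm (ι : Type*) [DecidableEq ι] {n : ℕ} (σ : Equiv.Perm (Fin n)) :
    Matrix (Fin n → ι) (Fin n → ι) ℂ :=
  fun i j => if j = i ∘ σ then 1 else 0

theorem factorPerm_mul_apply {n : ℕ} (σ : Equiv.Perm (Fin n))
    (M : Matrix (Fin n → ι) (Fin n → ι) ℂ) (i j : Fin n → ι) :
    (factorPerm ι σ * M) i j = M (i ∘ σ) j := by
  simp [Matrix.mul_apply, factorPerm]

theorem mul_factorPerm_apply {n : ℕ} (σ : Equiv.Perm (Fin n))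
    (M : Matrix (Fin n → ι) (Fin n → ι) ℂ) (i j : Fin n → ι) :
    (M * factorPerm ι σ) i j = M i (j ∘ σ.symm) := by
  have : ∀ l : Fin n → ι, j = l ∘ σ ↔ l = j ∘ σ.symm := fun l =>
    ⟨by rintro rfl; funext k; simp, by rintro rfl; funext k; simp⟩
  simp [Matrix.mul_apply, factorPerm, this]

theorem factorPerm_pow {n : ℕ} (σ : Equiv.Perm (Fin n)) (r : ℕ) :
    factorPerm ι σ ^ r = factorPerm ι (σ ^ r) := by
  induction r with
  | zero =>
    ext i j
    simp [factorPerm, Matrix.one_apply, eq_comm]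
  | succ r ih =>
    rw [pow_succ', ih]
    ext i j
    rw [factorPerm_mul_apply, pow_succ']
    rfl

theorem factorPerm_mul_tensorMatrix {n : ℕ} (σ : Equiv.Perm (Fin n)) (A : Fin n → Matrix ι ι ℂ) :
    factorPerm ι σ * tensorMatrix A = tensorMatrix (A ∘ σ.symm) * factorPerm ι σ := by
  ext i j
  rw [factorPerm_mul_apply, mul_factorPerm_apply]
  exact Fintype.prod_equiv σ _ _ fun k => by simp

/-- Sum over paths from a to b: `Fin.cons a i` lists the vertices, and the final indicator forces
the last one to be b. -/
theorem list_prod_apply {n : ℕ} (A : Fin n → Matrix ι ι ℂ) (a b : ι) :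
    (List.ofFn A).prod a b = ∑ i : Fin n → ι,
      (∏ k : Fin n, A k ((Fin.cons a i : Fin (n + 1) → ι) k.castSucc) (i k)) *
        if (Fin.cons a i : Fin (n + 1) → ι) (Fin.last n) = b then 1 else 0 := by
  induction n generalizing a with
  | zero => simp [Matrix.one_apply]
  | succ n ih =>
    rw [List.ofFn_succ, List.prod_cons, Matrix.mul_apply,
      ← (Fin.consEquiv fun _ : Fin (n + 1) => ι).sum_comp, Fintype.sum_prod_type]
    refine Finset.sum_congr rfl fun c _ => ?_
    rw [ih, Finset.mul_sum]
    refine Finset.sum_congr rfl fun i _ => ?_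
    rw [Fin.prod_univ_succ, mul_assoc]
    rfl

/-- Both sides sum over closed paths: the shift makes the column index of each factor the row index
of the next. -/
theorem trace_list_prod {n : ℕ} (A : Fin (n + 1) → Matrix ι ι ℂ) :
    (List.ofFn A).prod.trace = (factorPerm ι (finRotate (n + 1)).symm * tensorMatrix A).trace := by
  simp only [Matrix.trace, Matrix.diag_apply, list_prod_apply, factorPerm_mul_apply]
  rw [Finset.sum_comm]
  refine Finset.sum_congr rfl fun i _ => ?_
  have h1 : ∀ a : ι, (Fin.cons a i : Fin (n + 2) → ι) (Fin.last (n + 1)) = i (Fin.last n) :=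
    fun a => rfl
  simp only [h1, mul_ite, mul_one, mul_zero, Finset.sum_ite_eq, Finset.mem_univ, if_true]
  refine Finset.prod_congr rfl fun k _ => ?_
  congr 1
  refine Fin.cases ?_ (fun l => ?_) k
  · have : (finRotate (n + 1)).symm 0 = Fin.last n := by
      rw [Equiv.symm_apply_eq, finRotate_last]
    simp [this]
  · have : (finRotate (n + 1)).symm l.succ = l.castSucc := by
      rw [Equiv.symm_apply_eq, finRotate_apply, Fin.coeSucc_eq_succ]
    rw [Function.comp_apply, this]
    rfl

/-- Rotation moves the first factor to the end, which replaces the product by a conjugate. -/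
theorem prod_ofFn_comp_finRotate_eq_one {G : Type*} [Group G] {n : ℕ} (a : Fin (n + 1) → G) :
    (List.ofFn (a ∘ finRotate (n + 1))).prod = 1 ↔ (List.ofFn a).prod = 1 := by
  have h1 : List.ofFn (a ∘ finRotate (n + 1)) = (List.ofFn fun k : Fin n => a k.succ) ++ [a 0] := by
    rw [List.ofFn_succ', List.concat_eq_append]
    simp [Fin.coeSucc_eq_succ]
  rw [h1, List.ofFn_succ]
  simp only [List.prod_append, List.prod_cons, List.prod_nil, mul_one]
  exact mul_eq_one_comm

end CyclicTensors

/-! ### Indicators are algebraic integers. -/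

section Integrality

open DrinfeldDouble

variable {G : Type u} [Group G] [Fintype G] [DecidableEq G]

/-- The products are left unevaluated here, so that a representation can be applied factor by factor
and the trace moved to a tensor power. -/
theorem sweedlerPower_basis_eq_sum_list (m : ℕ) (g x : G) :
    sweedlerPower (DrinfeldDouble G) m (basis (g, x)) = ∑ a : Fin m → G,
      if (List.ofFn a).prod = g then
        (List.ofFn fun k => (basis (a k, x) : DrinfeldDouble G)).prod else 0 := by
  induction m generalizing g with
  | zero =>
    rw [sweedlerPower_zero, counit_basis]
    simp only [List.ofFn_zero, List.prod_nil, Finset.univ_unique, Finset.sum_const,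
      Finset.card_singleton, one_smul, eq_comm (a := (1 : G))]
    split_ifs <;> simp
  | succ m ih =>
    rw [sweedlerPower_succ_basis, ← (Fin.consEquiv fun _ : Fin (m + 1) => G).sum_comp,
      Fintype.sum_prod_type]
    refine Finset.sum_congr rfl fun h _ => ?_
    rw [ih, Finset.mul_sum]
    refine Finset.sum_congr rfl fun a _ => ?_
    simp only [Fin.consEquiv_apply, List.ofFn_succ, Fin.cons_zero, Fin.cons_succ, List.prod_cons,
      mul_ite, mul_zero, eq_inv_mul_iff_mul_eq]

variable {ι : Type*} [Fintype ι] [DecidableEq ι] (T : DrinfeldDouble G →ₐ[ℂ] Matrix ι ι ℂ)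

/-- The diagonal action of `x ∈ G` on the part of degree `1` of a tensor power. -/
noncomputable def diagonalAction (n : ℕ) (x : G) : Matrix (Fin n → ι) (Fin n → ι) ℂ :=
  ∑ a : Fin n → G with (List.ofFn a).prod = 1, tensorMatrix fun k => T (basis (a k, x))

theorem prod_ofFn_conj {G : Type*} [Group G] {n : ℕ} (a : Fin n → G) (x : G) :
    (List.ofFn fun k => x * a k * x⁻¹).prod = x * (List.ofFn a).prod * x⁻¹ := by
  have := map_list_prod (MulAut.conj x) (List.ofFn a)
  rw [List.map_ofFn] at this
  exact this.symm

/-- A degree sequence a on the left meets exactly one on the right, its conjugate by x⁻¹, whose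
product is again 1. The action need not be unital: x = 1 acts as the projection to degree 1. -/
theorem diagonalAction_mul (n : ℕ) (x y : G) :
    diagonalAction T n x * diagonalAction T n y = diagonalAction T n (x * y) := by
  rw [diagonalAction, diagonalAction, Finset.sum_mul_sum]
  refine Finset.sum_congr rfl fun a ha => ?_
  have hmul : ∀ b : Fin n → G, (tensorMatrix fun k => T (basis (a k, x))) *
      (tensorMatrix fun k => T (basis (b k, y))) = tensorMatrix fun k =>
        T (if a k = x * b k * x⁻¹ then basis (a k, x * y) else 0) := fun b => by
    simp only [tensorMatrix_mul, ← map_mul, basis_mul_basis]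
  simp only [hmul]
  rw [Finset.sum_eq_single fun k => x⁻¹ * a k * x⁻¹⁻¹]
  · congr 1
    funext k
    rw [if_pos (by group)]
  · intro b _ hb
    obtain ⟨k, hk⟩ := Function.ne_iff.1 hb
    refine tensorMatrix_eq_zero _ (k := k) ?_
    rw [if_neg, map_zero]
    intro e
    apply hk
    rw [e]; group
  · intro h
    refine absurd ?_ h
    rw [Finset.mem_filter, prod_ofFn_conj, (Finset.mem_filter.1 ha).2]
    simp

theorem factorPerm_commute_diagonalAction (n : ℕ) (x : G) :
    Commute (factorPerm ι (finRotate (n + 1)).symm) (diagonalAction T (n + 1) x) := by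
  change _ * _ = _ * _
  rw [diagonalAction, Finset.mul_sum, Finset.sum_mul]
  refine Finset.sum_equiv ((finRotate (n + 1)).symm.arrowCongr (Equiv.refl G)) (fun a => ?_)
    fun a _ => ?_
  · simp only [Finset.mem_filter, Finset.mem_univ, true_and]
    exact (prod_ofFn_comp_finRotate_eq_one a).symm
  · rw [factorPerm_mul_tensorMatrix]
    rfl

theorem trace_factorPerm_mul_diagonalAction (n : ℕ) (x : G) :
    (factorPerm ι (finRotate (n + 1)).symm * diagonalAction T (n + 1) x).trace =
      (T (sweedlerPower (DrinfeldDouble G) (n + 1) (basis (1, x)))).trace := by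
  rw [diagonalAction, Finset.mul_sum, Matrix.trace_sum, sweedlerPower_basis_eq_sum_list,
    ← Finset.sum_filter, map_sum, Matrix.trace_sum]
  refine Finset.sum_congr rfl fun a _ => ?_
  rw [← trace_list_prod, map_list_prod, List.map_ofFn]
  rfl

/-- The trace is that of CP, where C is the cyclic shift and P averages the diagonal action. They
commute, C has finite order and P is idempotent, so (CP)^(r+1) = CP for some r > 0. -/
theorem isIntegral_trace_sweedlerPower_integral {m : ℕ} (hm : 0 < m) :
    IsIntegral ℤ (T (sweedlerPower (DrinfeldDouble G) m integral)).trace := by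
  obtain ⟨n, rfl⟩ := Nat.exists_eq_succ_of_ne_zero hm.ne'
  let C := factorPerm ι (finRotate (n + 1)).symm
  let P : Matrix (Fin (n + 1) → ι) (Fin (n + 1) → ι) ℂ :=
    (Fintype.card G : ℂ)⁻¹ • ∑ x : G, diagonalAction T (n + 1) x
  have hcard : (Fintype.card G : ℂ) ≠ 0 := by exact_mod_cast Fintype.card_ne_zero
  have hCP : Commute C P :=
    (Commute.sum_right _ _ _ fun x _ => factorPerm_commute_diagonalAction T n x).smul_right _
  have hP : P * P = P := by
    have h1 : ∀ x : G, diagonalAction T (n + 1) x * P = P := fun x => by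
      simp only [P, mul_smul_comm, Finset.mul_sum, diagonalAction_mul]
      congr 1
      exact Fintype.sum_equiv (Equiv.mulLeft x) _ _ fun y => rfl
    nth_rewrite 1 [show P = (Fintype.card G : ℂ)⁻¹ • ∑ x : G, diagonalAction T (n + 1) x from rfl]
    rw [smul_mul_assoc, Finset.sum_mul, Finset.sum_congr rfl fun x _ => h1 x, Finset.sum_const,
      Finset.card_univ, ← Nat.cast_smul_eq_nsmul ℂ, smul_smul, inv_mul_cancel₀ hcard, one_smul]
  have hC : C ^ orderOf (finRotate (n + 1)).symm = 1 := by
    rw [factorPerm_pow, pow_orderOf_eq_one, ← pow_zero (finRotate (n + 1)).symm, ← factorPerm_pow,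
      pow_zero]
  have hpow : (C * P) ^ (orderOf (finRotate (n + 1)).symm + 1) = C * P := by
    rw [hCP.mul_pow, pow_succ C, hC, one_mul, (show IsIdempotentElem P from hP).pow_succ_eq]
  have htr : (T (sweedlerPower (DrinfeldDouble G) (n + 1) integral)).trace = (C * P).trace := by
    simp only [P, C, integral, map_smul, map_sum, Matrix.trace_smul, Matrix.trace_sum,
      mul_smul_comm, Finset.mul_sum, trace_factorPerm_mul_diagonalAction]
  rw [Nat.succ_eq_add_one, htr]
  exact isIntegral_trace_of_pow_succ_eq (orderOf_pos _) hpow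

/-- Frobenius-Schur indicators of finite-dimensional modules are algebraic integers. -/
theorem isIntegral_nu {m : ℕ} (hm : 0 < m) (V : Type u) [AddCommGroup V] [Module ℂ V]
    [Module (DrinfeldDouble G) V] [IsScalarTower ℂ (DrinfeldDouble G) V]
    [FiniteDimensional ℂ V] : IsIntegral ℤ (nu G m V) := by
  let b := Module.finBasis ℂ V
  let T : DrinfeldDouble G →ₐ[ℂ] Matrix _ _ ℂ :=
    (LinearMap.toMatrixAlgEquiv b).toAlgHom.comp (Algebra.lsmul ℂ ℂ V)
  rw [nu, LinearMap.trace_eq_matrix_trace ℂ b]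
  exact isIntegral_trace_sweedlerPower_integral T hm

end Integrality

/-! ### From invariant counts to integral indicators. -/

section Rationality

open DrinfeldDouble Polynomial

variable {G : Type u} [Group G] [Fintype G] [DecidableEq G]

/-- The group element `x` as an element of `D(G)`. -/
noncomputable def ofGroup (x : G) : DrinfeldDouble G := ∑ g : G, basis (g, x)

theorem basis_mul_ofGroup (g x y : G) :
    (basis (g, x) : DrinfeldDouble G) * ofGroup y = basis (g, x * y) := by
  rw [ofGroup, Finset.mul_sum, Finset.sum_eq_single (x⁻¹ * g * x)]
  · rw [basis_mul_basis, if_pos (by group)]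
  · intro h _ hh
    rw [basis_mul_basis, if_neg]
    intro e
    exact hh (by rw [e]; group)
  · simp

theorem ofGroup_mul_basis (g x y : G) :
    ofGroup y * (basis (g, x) : DrinfeldDouble G) = basis (y * g * y⁻¹, y * x) := by
  rw [ofGroup, Finset.sum_mul, Finset.sum_eq_single (y * g * y⁻¹)]
  · rw [basis_mul_basis, if_pos rfl]
  · intro h _ hh
    rw [basis_mul_basis, if_neg hh]
  · simp

theorem ofGroup_one : ofGroup (1 : G) = 1 := one_eq_sum.symm

theorem ofGroup_pow (x : G) (j : ℕ) : ofGroup x ^ j = ofGroup (x ^ j) := by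
  induction j with
  | zero => rw [pow_zero, pow_zero, ofGroup_one]
  | succ j ih =>
    rw [pow_succ, ih, pow_succ]
    nth_rewrite 1 [ofGroup]
    simp only [Finset.sum_mul, basis_mul_ofGroup]
    rfl

/-- For commuting `b` and `w`, the traces of `e_b w ^ j` are values of one polynomial. -/
theorem exists_polynomial_trace_basis_pow {ζ : ℂ} (hζ : IsPrimitiveRoot ζ (Nat.card G))
    (V : Type u) [AddCommGroup V] [Module ℂ V] [Module (DrinfeldDouble G) V]
    [IsScalarTower ℂ (DrinfeldDouble G) V] [FiniteDimensional ℂ V] {b w : G} (h : Commute w b) :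
    ∃ P : ℚ[X], ∀ j : ℕ, LinearMap.trace ℂ V
      (Algebra.lsmul ℂ ℂ V (basis (b, w ^ j) : DrinfeldDouble G)) = aeval (ζ ^ j) P := by
  have hN : 0 < Nat.card G := Nat.card_pos
  have hR : ofGroup w ^ Nat.card G = 1 := by rw [ofGroup_pow, pow_card_eq_one', ofGroup_one]
  have hc : Commute (basis (b, 1) : DrinfeldDouble G) (ofGroup w) := by
    change _ * _ = _ * _
    rw [basis_mul_ofGroup, ofGroup_mul_basis, one_mul, mul_one, h.eq, mul_inv_cancel_right]
  -- A product of two commuting idempotents; its trace on V is therefore a rank.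
  let e : ℕ → DrinfeldDouble G := fun k => basis (b, 1) * spectralProj (Nat.card G) ζ (ofGroup w) k
  have he : ∀ k, e k * e k = e k := fun k => by
    simp only [e]
    rw [(commute_spectralProj hc k).symm.mul_mul_mul_comm, spectralProj_mul_self hN hζ hR,
      basis_mul_basis, if_pos (by group), one_mul]
  have ht : ∀ k, ∃ t : ℕ, LinearMap.trace ℂ V (Algebra.lsmul ℂ ℂ V (e k)) = t := fun k =>
    exists_nat_trace_of_mul_self (by rw [← map_mul, he])
  choose t ht using ht
  refine ⟨∑ k ∈ Finset.range (Nat.card G), monomial k (t k : ℚ), fun j => ?_⟩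
  have hb : (basis (b, w ^ j) : DrinfeldDouble G) =
      ∑ k ∈ Finset.range (Nat.card G), ζ ^ (k * j) • e k := by
    rw [← one_mul (w ^ j), ← basis_mul_ofGroup, ← ofGroup_pow, pow_eq_sum_spectralProj hN hζ hR,
      Finset.mul_sum]
    simp only [mul_smul_comm, e]
  rw [hb, map_sum, map_sum, map_sum]
  refine Finset.sum_congr rfl fun k _ => ?_
  rw [map_smul, map_smul, ht, aeval_monomial, ← pow_mul, mul_comm j k, smul_eq_mul, mul_comm]
  simp

theorem nu_eq_sum_powCount (m : ℕ) (V : Type u) [AddCommGroup V] [Module ℂ V]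
    [Module (DrinfeldDouble G) V] [IsScalarTower ℂ (DrinfeldDouble G) V] :
    nu G m V = (Fintype.card G : ℂ)⁻¹ * ∑ b : G, ∑ w : G, (powCount m b w⁻¹ : ℂ) *
      LinearMap.trace ℂ V (Algebra.lsmul ℂ ℂ V (basis (b, w) : DrinfeldDouble G)) := by
  rw [nu, sweedlerPower_integral]
  simp only [map_smul, map_sum, smul_eq_mul]

theorem exists_rat_nu {m : ℕ}
    (h : ∀ (a y : G) (n : ℕ), n.Coprime (Nat.card G) → powCount m a (y ^ n) = powCount m a y)
    (V : Type u) [AddCommGroup V] [Module ℂ V] [Module (DrinfeldDouble G) V]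
    [IsScalarTower ℂ (DrinfeldDouble G) V] [FiniteDimensional ℂ V] :
    ∃ r : ℚ, nu G m V = r := by
  have hN : 0 < Nat.card G := Nat.card_pos
  have : NeZero (Nat.card G) := ⟨hN.ne'⟩
  obtain ⟨ζ, hζ⟩ : ∃ ζ : ℂ, IsPrimitiveRoot ζ (Nat.card G) :=
    ⟨_, Complex.isPrimitiveRoot_exp _ hN.ne'⟩
  have hpoly : ∀ b w : G, ∃ P : ℚ[X], ∀ j : ℕ, (powCount m b w⁻¹ : ℂ) * LinearMap.trace ℂ V
      (Algebra.lsmul ℂ ℂ V (basis (b, w ^ j) : DrinfeldDouble G)) = aeval (ζ ^ j) P := by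
    intro b w
    -- The trace polynomial requires b and w to commute; otherwise the count vanishes and the zero
    -- polynomial serves.
    by_cases h0 : powCount m b w⁻¹ = 0
    · exact ⟨0, fun j => by simp [h0]⟩
    · have hc : Commute w b := by simpa using (commute_of_powCount_ne_zero h0).inv_left
      obtain ⟨P, hP⟩ := exists_polynomial_trace_basis_pow hζ V hc
      exact ⟨C (powCount m b w⁻¹ : ℚ) * P, fun j => by rw [hP, map_mul, aeval_C]; simp⟩
  choose P hP using hpoly
  have hsum : ∀ n : ℕ, n.Coprime (Nat.card G) → aeval (ζ ^ n) (∑ b : G, ∑ w : G, P b w) =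
      ∑ b : G, ∑ w : G, (powCount m b w⁻¹ : ℂ) *
        LinearMap.trace ℂ V (Algebra.lsmul ℂ ℂ V (basis (b, w) : DrinfeldDouble G)) := by
    intro n hn
    simp only [map_sum, ← hP]
    refine Finset.sum_congr rfl fun b _ => ?_
    -- As n is prime to |G|, w ↦ w^n permutes G; invariance of the counts matches the coefficients.
    refine Fintype.sum_equiv (powCoprime hn.symm) _ _ fun w => ?_
    rw [powCoprime_apply, ← inv_pow, h _ _ _ hn]
  obtain ⟨r, hr⟩ := exists_rat_of_aeval_pow_eq hζ (∑ b : G, ∑ w : G, P b w) fun n hn => by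
    rw [hsum n hn, ← hsum 1 (Nat.coprime_one_left _), pow_one]
  refine ⟨(Fintype.card G : ℚ)⁻¹ * r, ?_⟩
  rw [nu_eq_sum_powCount, ← hsum 1 (Nat.coprime_one_left _), pow_one, hr]
  push_cast
  rfl

theorem exists_int_nu_of_powCount_pow {m : ℕ} (hm : 0 < m)
    (h : ∀ (a y : G) (n : ℕ), n.Coprime (Nat.card G) → powCount m a (y ^ n) = powCount m a y)
    (V : Type u) [AddCommGroup V] [Module ℂ V] [Module (DrinfeldDouble G) V]
    [IsScalarTower ℂ (DrinfeldDouble G) V] : ∃ n : ℤ, nu G m V = n := by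
  by_cases hV : FiniteDimensional ℂ V
  · obtain ⟨r, hr⟩ := exists_rat_nu h V
    exact exists_int_of_isIntegral_of_rat (isIntegral_nu hm V) hr
  -- In infinite dimension `LinearMap.trace` takes its default value 0.
  · refine ⟨0, ?_⟩
    have : ¬ ∃ s : Finset V, Nonempty (Module.Basis s ℂ V) := fun ⟨s, ⟨b⟩⟩ =>
      hV (Module.Finite.of_basis b)
    rw [nu, LinearMap.trace, dif_neg this]
    simp

end Rationality

/-! ### The counting criterion. -/

section Criterion

/-- Since n is invertible modulo |G|, y is a power of y^n. -/
theorem commute_of_commute_pow {G : Type u} [Group G] {a y : G} {n : ℕ}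
    (hn : n.Coprime (Nat.card G)) (h : Commute (y ^ n) a) : Commute y a := by
  have := h.zpow_left ((Nat.card G).gcdB n)
  have hy : (y ^ n) ^ ((Nat.card G).gcdB n) = y := (powCoprime hn.symm).symm_apply_apply y
  rwa [hy] at this

/-- The criterion of Iovanov, Mason and Montgomery for the `FSZ_m` property. -/
theorem isFSZ_iff_powCount_pow {G : Type u} [Group G] [Finite G] {m : ℕ} (hm : 0 < m) :
    IsFSZ G m ↔ ∀ (a y : G) (n : ℕ), Commute y a → n.Coprime (Nat.card G) →
      powCount m a (y ^ n) = powCount m a y := by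
  let _ : Fintype G := Fintype.ofFinite G
  let _ : DecidableEq G := Classical.decEq G
  refine ⟨fun H a y n hc hn => powCount_pow_of_forall_simple H hc hn, fun h V _ _ _ _ _ =>
    exists_int_nu_of_powCount_pow hm (fun a y n hn => ?_) V⟩
  by_cases hc : Commute y a
  · exact h a y n hc hn
  · have h1 : powCount m a y = 0 := by
      by_contra h0
      exact hc (commute_of_powCount_ne_zero h0)
    have h2 : powCount m a (y ^ n) = 0 := by
      by_contra h0
      exact hc (commute_of_commute_pow hn (commute_of_powCount_ne_zero h0))
    rw [h1, h2]

end Criterion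

/-! ### Passing to subgroups and shifting by central powers. -/

section PowCount

variable {G : Type u} [Group G]

/-- A solution commutes with its own m-th power y, hence already lies in K. -/
theorem powCount_coe (m : ℕ) (K : Subgroup G) (a y : K)
    (h : ∀ x : G, Commute x y → x ∈ K) : powCount m (a : G) (y : G) = powCount m a y := by
  have hK : ∀ x : G, x ^ m = y → x ∈ K := fun x hx => h x (hx ▸ Commute.self_pow x m)
  symm
  refine Nat.card_congr
    { toFun := fun x => ⟨x.1, by exact_mod_cast congrArg (Subtype.val) x.2.1,
        by exact_mod_cast congrArg (Subtype.val) x.2.2⟩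
      invFun := fun x => ⟨⟨x.1, hK _ x.2.1⟩,
        Subtype.ext x.2.1, Subtype.ext x.2.2⟩
      left_inv := fun x => rfl
      right_inv := fun x => rfl }

/-- Right multiplication by v carries the solutions for u to those for u v^m. -/
theorem powCount_mul_pow_of_mem_center {m : ℕ} {v : G} (hv : v ∈ Subgroup.center G) (a u : G) :
    powCount m a (u * v ^ m) = powCount m a u := by
  have hc : ∀ x : G, Commute x v := fun x => Subgroup.mem_center_iff.1 hv x
  refine (Nat.card_congr ((Equiv.mulRight v).subtypeEquiv fun x => ?_)).symm
  rw [Equiv.coe_mulRight, ← mul_assoc, (hc x).mul_pow, (hc (a * x)).mul_pow, mul_left_inj,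
    mul_left_inj]

/-- The root is found among the powers of w, so it is central whenever w is. -/
theorem exists_natPow_pow_eq {w : G} {m : ℕ} (h : (orderOf w).Coprime m) :
    ∃ j : ℕ, (w ^ j) ^ m = w := by
  obtain ⟨j, hj⟩ := exists_pow_eq_self_of_coprime h.symm
  exact ⟨j, by rw [← pow_mul, mul_comm, pow_mul, hj]⟩

end PowCount

/-! ### Expansions for central elements. -/

section CentralExpansion

variable {G : Type u} [Group G]

theorem irrCharRestrict_bijective {z : G} (hz : z ∈ Subgroup.center G) :
    Function.Bijective (irrCharRestrict hz) := by
  have hmem : ∀ g : G, g ∈ Subgroup.centralizer {z} := fun g =>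
    Subgroup.mem_centralizer_singleton_iff.2 (Subgroup.mem_center_iff.1 hz g)
  refine ⟨fun χ ψ h => Subtype.ext (funext fun g => ?_), fun χ => ?_⟩
  · exact congrFun (congrArg Subtype.val h) ⟨g, hmem g⟩
  · exact ⟨⟨_, irrChar_comp ((MulEquiv.subgroupCongr (Subgroup.centralizer_eq_top_iff_subset.2
      (Set.singleton_subset_iff.2 hz))).trans Subgroup.topEquiv).symm χ.property⟩, rfl⟩

variable [Finite G]

/-- Rewriting the expansion over Irr(G) makes different central z comparable, although their
centralizers are formally different types. -/
theorem powCount_eq_finsum_beta (m : ℕ) {z : G} (hz : z ∈ Subgroup.center G) (g : G) :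
    (powCount m g z : ℂ) =
      ∑ᶠ χ : irrChar G, beta m z (irrCharRestrict hz χ) * (χ : G → ℂ) g := by
  have hg : g ∈ Subgroup.centralizer {z} :=
    Subgroup.mem_centralizer_singleton_iff.2 (Subgroup.mem_center_iff.1 hz g)
  refine (gammaFun_eq_sum_beta m z ⟨g, hg⟩).trans ?_
  exact (finsum_eq_of_bijective _ (irrCharRestrict_bijective hz) fun χ => rfl).symm

theorem beta_irrCharRestrict_eq {m : ℕ} {y u : G} (hy : y ∈ Subgroup.center G)
    (hu : u ∈ Subgroup.center G) (h : ∀ g : G, powCount m g y = powCount m g u) (χ : irrChar G) :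
    beta m y (irrCharRestrict hy χ) = beta m u (irrCharRestrict hu χ) := by
  have hclass : ∀ g k : G, (powCount m (k * g * k⁻¹) u : ℂ) = powCount m g u := fun g k => by
    have hk : u = k * u * k⁻¹ := by rw [Subgroup.mem_center_iff.1 hu k]; group
    nth_rewrite 1 [hk]
    rw [powCount_conj]
  exact congrFun ((existsUnique_irrChar_expansion _ hclass).unique
    (fun g => by rw [← h, powCount_eq_finsum_beta m hy])
    (powCount_eq_finsum_beta m hu)) χ

end CentralExpansion

/-! ### The two assertions. -/

theorem isFSZ_of_forall_centralizer {G : Type u} [Group G] [Finite G] {p k : ℕ} (hp : p.Prime)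
    (H : ∀ z : G, z ≠ 1 → IsPElement p z → IsFSZ (Subgroup.centralizer {z}) (p ^ k)) :
    IsFSZ G (p ^ k) := by
  have hq : 0 < p ^ k := pow_pos hp.pos k
  refine (isFSZ_iff_powCount_pow hq).2 fun a y n hya hn => ?_
  -- This places the solutions for y^n in the same centralizer as those for y.
  have hpow : ∀ x : G, Commute x (y ^ n) → Commute x y := fun x hx =>
    (commute_of_commute_pow hn hx.symm).symm
  by_cases hpy : p ∣ orderOf y
  -- An element of order p which is a power of y, so that C_G(y) is contained in C_G(u).
  · let u : G := y ^ (orderOf y / p)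
    have hu : orderOf u = p := orderOf_pow_orderOf_div (orderOf_pos y).ne' hpy
    have hu1 : u ≠ 1 := fun e => hp.one_lt.ne (by rw [← hu, e, orderOf_one])
    have hcu : ∀ x : G, Commute x y → x ∈ Subgroup.centralizer {u} := fun x hx =>
      Subgroup.mem_centralizer_singleton_iff.2 (hx.pow_right _).eq
    let a' : Subgroup.centralizer {u} := ⟨a, hcu a hya.symm⟩
    let y' : Subgroup.centralizer {u} := ⟨y, hcu y (Commute.refl y)⟩
    have h1 := (isFSZ_iff_powCount_pow hq).1 (H u hu1 ⟨1, by rw [hu, pow_one]⟩) a' y' n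
      (Subtype.ext hya) (hn.coprime_dvd_right (Subgroup.card_subgroup_dvd_card _))
    rw [← powCount_coe _ _ a' (y' ^ n) fun x hx => hcu x (hpow x hx),
      ← powCount_coe _ _ a' y' hcu] at h1
    exact h1
  · obtain ⟨j, hj⟩ := exists_natPow_pow_eq (w := y) (m := p ^ k)
      (((Nat.Prime.coprime_iff_not_dvd hp).2 hpy).symm.pow_right k)
    have hcy : ∀ x : G, Commute x y → x ∈ Subgroup.centralizer {y} := fun x hx =>
      Subgroup.mem_centralizer_singleton_iff.2 hx.eq
    let a' : Subgroup.centralizer {y} := ⟨a, hcy a hya.symm⟩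
    let y' : Subgroup.centralizer {y} := ⟨y, hcy y (Commute.refl y)⟩
    have hy' : y' ∈ Subgroup.center (Subgroup.centralizer {y}) :=
      Subgroup.mem_center_iff.2 fun g =>
        Subtype.ext (Subgroup.mem_centralizer_singleton_iff.1 g.2)
    have hj' : (y' ^ j) ^ p ^ k = y' := Subtype.ext hj
    -- In C_G(y) both y and y^n are p^k-th powers of central elements, so both counts equal the one
    -- at 1.
    have h1 : powCount (p ^ k) a' y' = powCount (p ^ k) a' 1 := by
      nth_rewrite 1 [← hj', ← one_mul ((y' ^ j) ^ p ^ k)]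
      exact powCount_mul_pow_of_mem_center (pow_mem hy' j) a' 1
    have h2 : powCount (p ^ k) a' (y' ^ n) = powCount (p ^ k) a' 1 := by
      have e : y' ^ n = 1 * ((y' ^ j) ^ n) ^ p ^ k := by
        rw [one_mul, pow_right_comm, hj']
      rw [e]
      exact powCount_mul_pow_of_mem_center (pow_mem (pow_mem hy' j) n) a' 1
    have h3 := h2.trans h1.symm
    rw [← powCount_coe _ _ a' (y' ^ n) fun x hx => hcy x (hpow x hx),
      ← powCount_coe _ _ a' y' hcy] at h3
    exact h3

theorem powCount_eq_of_isPPart {G : Type u} [Group G] {p : ℕ} (k : ℕ) {y u : G}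
    (hy : y ∈ Subgroup.center G) (hu : IsPPart p y u) (g : G) :
    powCount (p ^ k) g y = powCount (p ^ k) g u := by
  have huc := hu.mem_center hy
  obtain ⟨-, w, -, rfl, hw⟩ := hu
  have hwc : w ∈ Subgroup.center G := (Subgroup.mul_mem_cancel_left _ huc).1 hy
  obtain ⟨j, hj⟩ := exists_natPow_pow_eq (hw.pow_right k)
  nth_rewrite 1 [← hj]
  exact powCount_mul_pow_of_mem_center (pow_mem hwc j) g u

end FSZ

theorem mainTheorem11 {G : Type u} [Group G] [Finite G] (p q : ℕ) (hp : p.Prime)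
    (hq : ∃ k : ℕ, q = p ^ k) :
    (¬ FSZ.IsFSZ G q →
      ∃ z : G, z ≠ 1 ∧ FSZ.IsPElement p z ∧ ¬ FSZ.IsFSZ (Subgroup.centralizer {z}) q) ∧
    (∀ (y : G) (hy : y ∈ Subgroup.center G) (u : G) (hu : FSZ.IsPPart p y u)
      (χ : FSZ.irrChar G),
      FSZ.beta q y (FSZ.irrCharRestrict hy χ) =
        FSZ.beta q u (FSZ.irrCharRestrict (hu.mem_center hy) χ)) := by
  obtain ⟨k, rfl⟩ := hq
  refine ⟨fun h => ?_, fun y hy u hu χ => FSZ.beta_irrCharRestrict_eq hy (hu.mem_center hy)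
    (FSZ.powCount_eq_of_isPPart k hy hu) χ⟩
  by_contra! hc
  exact h (FSZ.isFSZ_of_forall_centralizer hp hc)
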